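/- Let $\Omega\subseteq\mathbb R^3$ be open, with coordinates $(x,y,z)$, and let $I\subseteq\mathbb R$ be its projection to the $x$-axis. Consider the system of two ordinary differential equations, linear in the first derivatives, $$y''+C^2_2\,y'+C^2_3\,z'+D^2=0,\qquad z''+C^3_2\,y'+C^3_3\,z'+D^3=0,$$ where $'=d/dx$, the $C^a_b=C^a_b(x)$ ($a,b\in\{2,3\}$) are smooth functions on $I$ (independent of $y$ and $z$), and $D^a=D^a(x,y,z)$ are smooth functions on $\Omega$ (superscripts are indices, not powers). Call a system on $\Omega$ linearizable by point transformations to the free-particle system if every point of $\Omega$ has an open neighbourhood $V\subseteq\Omega$ and a smooth diffeomorphism $(x,y,z)\mapsto(X,Y,Z)$ of $V$ onto an open subset of $\mathbb R^3$ which transforms the system into $d^2Y/dX^2=0$, $d^2Z/dX^2=0$; that is, whenever it maps the graph in $V$ of a $C^2$ pair $(y(x),z(x))$ on an open interval onto the graph of a $C^2$ pair $(Y(X),Z(X))$ on an open interval, the first pair solves the given system if and only if the second solves the free-particle system. Then the system is linearizable by point transformations to the free-particle system if and only if at every point of $\Omega$ $$\tfrac12C^3_{2x}+\tfrac14C^3_3C^3_2+\tfrac14C^2_2C^3_2=D^3_y,$$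 $$\tfrac12C^2_{3x}+\tfrac14C^2_3C^3_3+\tfrac14C^2_3C^2_2=D^2_z,$$ $$\tfrac12C^3_{3x}-\tfrac12C^2_{2x}+\tfrac14C^3_3C^3_3-\tfrac14C^2_2C^2_2=D^3_z-D^2_y,$$ where the subscripts $x,y,z$ at the end denote partial derivatives. In particular, for smooth $\omega_1,\omega_2$ on $I$, the anisotropic oscillator $y''+\omega_1(x)y=0$, $z''+\omega_2(x)z=0$ on $\Omega$ is linearizable by point transformations to the free-particle system if and only if $\omega_1=\omega_2$ on $I$. -/

import Mathlib

open Set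
open scoped ContDiff

/-- The space of the variables `(x, y, z)`: independent variable `x`, dependent `y` and `z`. -/
abbrev XYZ : Type := ℝ × ℝ × ℝ

/-- A system of two second-order ODEs in normal form, `y'' + f₁ = 0`, `z'' + f₂ = 0`, where
`(f₁, f₂)` is a function of the point `(x, y, z)` and of the first derivatives `(y', z')`. -/
abbrev SecondOrderSystem : Type := XYZ → ℝ × ℝ → ℝ × ℝ

/-- The system `y'' + C22 y' + C23 z' + D2 = 0`, `z'' + C32 y' + C33 z' + D3 = 0`, where the
coefficients of the first derivatives depend on `x` only and `D2`, `D3` depend on `(x, y, z)`.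
(`Cab` stands for the coefficient with upper index `a` and lower index `b`.) -/
def linearInDerivatives (C22 C23 C32 C33 : ℝ → ℝ) (D2 D3 : XYZ → ℝ) : SecondOrderSystem :=
  fun p v =>
    (C22 p.1 * v.1 + C23 p.1 * v.2 + D2 p, C32 p.1 * v.1 + C33 p.1 * v.2 + D3 p)

/-- The free-particle system `y'' = 0`, `z'' = 0`. -/
def freeParticle : SecondOrderSystem := fun _ _ => (0, 0)

/-- The system `y'' + ω₁(x) y = 0`, `z'' + ω₂(x) z = 0`. -/
def anisotropicOscillator (ω₁ ω₂ : ℝ → ℝ) : SecondOrderSystem :=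
  fun p _ => (ω₁ p.1 * p.2.1, ω₂ p.1 * p.2.2)

/-- The graph over `J` of the pair of functions `(y, z)`. -/
def curveGraph (J : Set ℝ) (y z : ℝ → ℝ) : Set XYZ :=
  (fun x => (x, y x, z x)) '' J

/-- `(y, z)`, of class `C²` on the open set `J`, solves the system `f` on `J`. -/
def IsSolutionOn (f : SecondOrderSystem) (J : Set ℝ) (y z : ℝ → ℝ) : Prop :=
  ContDiffOn ℝ 2 y J ∧ ContDiffOn ℝ 2 z J ∧
    ∀ x ∈ J,
      deriv (deriv y) x + (f (x, y x, z x) (deriv y x, deriv z x)).1 = 0 ∧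
      deriv (deriv z) x + (f (x, y x, z x) (deriv y x, deriv z x)).2 = 0

/-- The diffeomorphism `φ` (from the open set `φ.source` onto the open set `φ.target`) of the
space of independent and dependent variables transforms the system `f` into the system `g`:
whenever it carries the graph of a `C²` pair `(y, z)` on an open interval onto the graph of a
`C²` pair `(Y, Z)` on an open interval, `(y, z)` solves `f` if and only if `(Y, Z)` solves `g`. -/
def Transforms (φ : OpenPartialHomeomorph XYZ XYZ) (f g : SecondOrderSystem) : Prop :=
  ∀ (J K : Set ℝ) (y z Y Z : ℝ → ℝ),
    IsOpen J → J.OrdConnected → IsOpen K → K.OrdConnected →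
    ContDiffOn ℝ 2 y J → ContDiffOn ℝ 2 z J → ContDiffOn ℝ 2 Y K → ContDiffOn ℝ 2 Z K →
    curveGraph J y z ⊆ φ.source → φ '' curveGraph J y z = curveGraph K Y Z →
    (IsSolutionOn f J y z ↔ IsSolutionOn g K Y Z)

/-- The system `f`, considered on `Ω`, is transformable to the system `g` by (local, invertible,
smooth) point transformations: around each point of `Ω` there is a smooth local diffeomorphism
that transforms `f` into `g`. -/
def PointTransformable (Ω : Set XYZ) (f g : SecondOrderSystem) : Prop :=
  ∀ p ∈ Ω, ∃ φ : OpenPartialHomeomorph XYZ XYZ,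
    p ∈ φ.source ∧ φ.source ⊆ Ω ∧
    ContDiffOn ℝ ∞ φ φ.source ∧ ContDiffOn ℝ ∞ φ.symm φ.target ∧ Transforms φ f g

/-- The partial derivative with respect to `y`. -/
noncomputable def partialY (D : XYZ → ℝ) (p : XYZ) : ℝ :=
  deriv (fun t => D (p.1, t, p.2.2)) p.2.1

/-- The partial derivative with respect to `z`. -/
noncomputable def partialZ (D : XYZ → ℝ) (p : XYZ) : ℝ :=
  deriv (fun t => D (p.1, p.2.1, t)) p.2.2

/-! Write C for the matrix of the coefficients `Cab` and D for the pair (`D2`, `D3`). The three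
conditions say that the Jacobian of D in (y, z) is ½C' + ¼C² plus a scalar multiple of the identity.

Necessity. A straightening map φ pulls straight lines back to solutions, so along a solution the
second derivative of its image is parallel to the velocity
(`Transforms.exists_second_deriv_parallel`). Applying (Dφ)⁻¹ and eliminating the factor expresses
the system as a cubic polynomial in v with coefficients taken from D²φ (`Transforms.eq_of_fderiv`).
Since the system is linear in v, D²φ is determined up to three functions ψᵢ, the freedom of a
projective change of connection (`Transforms.exists_hessian`). Finally φ_xxy = φ_xyx and φ_xxz =
φ_xzx are compared in the frame Dφ. The off-diagonal components are the first two conditions; the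
diagonal ones contain the same unknown expression in the ψᵢ, which cancels in their difference
(`Transforms.partial_eq`).

Sufficiency. The conditions force D to be affine in (y, z) on a small cube
(`eq_affine_of_deriv_eq`), so the scalar λ depends on x only. The difference h between a solution
and a particular one satisfies h'' + Ch' + (½C' + ¼C² + λ)h = 0. If 2Q' = QC, then g = Qh satisfies
g'' + λg = 0. If moreover s'' + λs = 0 and dX = dx/s², then the second X-derivative of g/s is s³(g''
+ λg) (`deriv_deriv_eq_of_reparam`). Hence (x, h) ↦ (X, Qh/s) is a straightening map. -/

/-! ### Inverse functions and smooth local solutions of ODEs -/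

open Topology in
/-- A smooth function of one real variable with nonzero derivative at `t₀` restricts to a
diffeomorphism of an open interval around `t₀`. -/
theorem exists_interval_diffeo {x : ℝ → ℝ} {U : Set ℝ} {t₀ : ℝ} (hU : IsOpen U) (ht₀ : t₀ ∈ U)
    (hx : ContDiffOn ℝ ∞ x U) (hd : deriv x t₀ ≠ 0) :
    ∃ e : OpenPartialHomeomorph ℝ ℝ, (e : ℝ → ℝ) = x ∧ t₀ ∈ e.source ∧ e.source ⊆ U ∧
      e.source.OrdConnected ∧ e.target.OrdConnected ∧
      (∀ t ∈ e.source, deriv x t ≠ 0) ∧ ContDiffOn ℝ ∞ e.symm e.target := by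
  have hinf : (∞ : WithTop ℕ∞) ≠ 0 := by simp
  have hxt := hx.contDiffAt (hU.mem_nhds ht₀)
  have hF : HasFDerivAt x (ContinuousLinearEquiv.unitsEquivAut ℝ (Units.mk0 _ hd) : ℝ →L[ℝ] ℝ) t₀ :=
    (hxt.differentiableAt hinf).hasDerivAt.hasFDerivAt_equiv hd
  let e₀ := hxt.toOpenPartialHomeomorph x hF hinf
  have h₀ : t₀ ∈ e₀.source := hxt.mem_toOpenPartialHomeomorph_source hF hinf
  have hcd : ContinuousAt (deriv x) t₀ :=
    (hx.continuousOn_deriv_of_isOpen hU (by norm_cast)).continuousAt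
      (hU.mem_nhds ht₀)
  obtain ⟨ε, hε, hball⟩ := Metric.mem_nhds_iff.1 (Filter.inter_mem
    (Filter.inter_mem (hU.mem_nhds ht₀) (e₀.open_source.mem_nhds h₀)) (hcd.eventually_ne hd))
  let e := e₀.restrOpen (Metric.ball t₀ ε) Metric.isOpen_ball
  have hsrc : e.source = Metric.ball t₀ ε := by
    rw [OpenPartialHomeomorph.restrOpen_source]
    exact inter_eq_right.2 fun t ht => (hball ht).1.2
  have hex : (e : ℝ → ℝ) = x := rfl
  have hUe : ∀ t ∈ e.source, t ∈ U := fun t ht => (hball (hsrc ▸ ht)).1.1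
  have hde : ∀ t ∈ e.source, deriv x t ≠ 0 := fun t ht => (hball (hsrc ▸ ht)).2
  have hconn : e.source.OrdConnected := by
    rw [hsrc, Real.ball_eq_Ioo]; exact ordConnected_Ioo
  refine ⟨e, hex, hsrc ▸ Metric.mem_ball_self hε, hUe, hconn, ?_, hde, fun s hs => ?_⟩
  · rw [← e.image_source_eq_target]
    exact (hconn.isPreconnected.image _ e.continuousOn).ordConnected
  · have hs' := e.map_target hs
    have hxs := hx.contDiffAt (hU.mem_nhds (hUe _ hs'))
    exact (e.contDiffAt_symm_deriv (hde _ hs') hs (hxs.differentiableAt hinf).hasDerivAt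
      hxs).contDiffWithinAt

-- Picard–Lindelöf for the autonomous field (1, F), whose time component must then be t itself;
-- smoothness follows by bootstrapping the equation.
open Topology Filter in
theorem exists_local_solution {E : Type*} [NormedAddCommGroup E] [NormedSpace ℝ E]
    [CompleteSpace E] {F : ℝ × E → E} {W : Set (ℝ × E)} (hW : IsOpen W)
    (hF : ContDiffOn ℝ ∞ F W) {t₀ : ℝ} {e₀ : E} (h₀ : (t₀, e₀) ∈ W) :
    ∃ α : ℝ → E, α t₀ = e₀ ∧ ∀ᶠ t in 𝓝 t₀,
      (t, α t) ∈ W ∧ HasDerivAt α (F (t, α t)) t ∧ ContDiffAt ℝ ∞ α t := by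
  have hV : ContDiffAt ℝ 1 (fun q : ℝ × E => ((1 : ℝ), F q)) (t₀, e₀) :=
    contDiffAt_const.prodMk ((hF.contDiffAt (hW.mem_nhds h₀)).of_le (by norm_cast))
  obtain ⟨β, hβ₀, ε, hε, hβ⟩ :=
    hV.exists_forall_mem_closedBall_exists_eq_forall_mem_Ioo_hasDerivAt₀ t₀
  have ht₀ : t₀ ∈ Ioo (t₀ - ε) (t₀ + ε) := ⟨by linarith, by linarith⟩
  have h1 : ∀ t ∈ Ioo (t₀ - ε) (t₀ + ε), HasDerivAt (fun t => (β t).1 - t) 0 t := fun t ht => by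
    have h := (hβ t ht).hasFDerivAt.fst.hasDerivAt.sub (hasDerivAt_id t)
    simpa [Pi.sub_def] using h
  have hfst : ∀ t ∈ Ioo (t₀ - ε) (t₀ + ε), (β t).1 = t := fun t ht => by
    have := isOpen_Ioo.is_const_of_deriv_eq_zero isPreconnected_Ioo
      (fun s hs => (h1 s hs).differentiableAt.differentiableWithinAt)
      (fun s hs => (h1 s hs).deriv) ht ht₀
    simp only [hβ₀, sub_self] at this
    linarith
  have hcurve : ∀ t ∈ Ioo (t₀ - ε) (t₀ + ε), β t = (t, (β t).2) := fun t ht =>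
    Prod.ext (hfst t ht) rfl
  have hmem : ∀ᶠ t in 𝓝 t₀, t ∈ Ioo (t₀ - ε) (t₀ + ε) ∧ β t ∈ W :=
    (isOpen_Ioo.eventually_mem ht₀).and
      ((hβ t₀ ht₀).continuousAt.eventually_mem (hW.mem_nhds (hβ₀ ▸ h₀)))
  obtain ⟨N, hN, hNo, ht₀N⟩ := eventually_nhds_iff.1 hmem
  have hder : ∀ t ∈ N, HasDerivAt (fun t => (β t).2) (F (t, (β t).2)) t := fun t ht => by
    have := (hβ t (hN t ht).1).snd
    rwa [hcurve t (hN t ht).1] at this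
  have hmemW : ∀ t ∈ N, (t, (β t).2) ∈ W := fun t ht =>
    hcurve t (hN t ht).1 ▸ (hN t ht).2
  have hsmooth : ContDiffOn ℝ ∞ (fun t => (β t).2) N := by
    rw [contDiffOn_infty]
    intro n
    -- If α is Cⁿ, then α' = F(t, α) is Cⁿ, so α is Cⁿ⁺¹.
    induction n with
    | zero =>
      exact contDiffOn_zero.2 fun t ht => (hder t ht).continuousAt.continuousWithinAt
    | succ n ih =>
      push_cast
      rw [contDiffOn_succ_iff_deriv_of_isOpen hNo]
      refine ⟨fun t ht => (hder t ht).differentiableAt.differentiableWithinAt, by simp, ?_⟩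
      refine ContDiffOn.congr ?_ fun t ht => (hder t ht).deriv
      exact (contDiffOn_infty.1 hF n).comp (contDiffOn_id.prodMk ih) hmemW
  refine ⟨fun t => (β t).2, by simp [hβ₀], ?_⟩
  filter_upwards [hNo.mem_nhds ht₀N] with t ht
  exact ⟨hmemW t ht, hder t ht, hsmooth.contDiffAt (hNo.mem_nhds ht)⟩

open Topology in
theorem OpenPartialHomeomorph.fderiv_symm_comp_fderiv {E F : Type*} [NormedAddCommGroup E]
    [NormedSpace ℝ E] [NormedAddCommGroup F] [NormedSpace ℝ F] (φ : OpenPartialHomeomorph E F)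
    {p : E} (hp : p ∈ φ.source) (hφ : DifferentiableAt ℝ φ p)
    (hφs : DifferentiableAt ℝ φ.symm (φ p)) :
    (fderiv ℝ φ.symm (φ p)).comp (fderiv ℝ φ p) = ContinuousLinearMap.id ℝ E := by
  have h1 := hφs.hasFDerivAt.comp p hφ.hasFDerivAt
  have h2 : φ.symm ∘ φ =ᶠ[𝓝 p] id := by
    filter_upwards [φ.open_source.mem_nhds hp] with r hr using φ.left_inv hr
  exact (h1.congr_of_eventuallyEq h2.symm).unique (hasFDerivAt_id p)

/-! ### Necessity: pulling back straight lines -/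

open Topology in
/-- The image under `φ` of the integral curve with a given 1-jet is a straight line: its second
derivative is parallel to its velocity. -/
theorem Transforms.exists_second_deriv_parallel {φ : OpenPartialHomeomorph XYZ XYZ}
    {f : SecondOrderSystem} (hφ : ContDiffOn ℝ ∞ φ φ.source)
    (hφs : ContDiffOn ℝ ∞ φ.symm φ.target) (hT : Transforms φ f freeParticle)
    {p : XYZ} (hp : p ∈ φ.source) {v : ℝ × ℝ} (hv : (fderiv ℝ φ p (1, v)).1 ≠ 0) :
    ∃ μ : ℝ, fderiv ℝ (fderiv ℝ φ) p (1, v) (1, v) + fderiv ℝ φ p (0, -f p v)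
      = μ • fderiv ℝ φ p (1, v) := by
  have hinf : (∞ : WithTop ℕ∞) ≠ 0 := by simp
  set w := fderiv ℝ φ p (1, v) with hw
  set q := φ p with hq
  have hqt : q ∈ φ.target := φ.map_source hp
  -- Slopes of the line through φ(p) in the direction w; `hv` says that this line is a graph over
  -- the X-axis.
  set a := w.2.1 / w.1 with ha
  set b := w.2.2 / w.1 with hb
  have hwm : w = w.1 • ((1, a, b) : XYZ) := by
    ext <;> simp [ha, hb] <;> field_simp
  let Y : ℝ → ℝ := fun s => q.2.1 + (s - q.1) * a
  let Z : ℝ → ℝ := fun s => q.2.2 + (s - q.1) * b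
  let ℓ : ℝ → XYZ := fun s => (s, Y s, Z s)
  have hY : ContDiff ℝ ∞ Y := by fun_prop
  have hZ : ContDiff ℝ ∞ Z := by fun_prop
  have hℓ : ContDiff ℝ ∞ ℓ := contDiff_id.prodMk (hY.prodMk hZ)
  have hYd : ∀ s, HasDerivAt Y a s := fun s =>
    (((hasDerivAt_id s).sub_const q.1).mul_const a).const_add q.2.1 |>.congr_deriv (one_mul _)
  have hZd : ∀ s, HasDerivAt Z b s := fun s =>
    (((hasDerivAt_id s).sub_const q.1).mul_const b).const_add q.2.2 |>.congr_deriv (one_mul _)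
  have hℓd : ∀ s, HasDerivAt ℓ (1, a, b) s := fun s =>
    (hasDerivAt_id s).prodMk ((hYd s).prodMk (hZd s))
  have hℓq : ℓ q.1 = q := by simp [ℓ, Y, Z]
  let c : ℝ → XYZ := fun s => φ.symm (ℓ s)
  let U : Set ℝ := ℓ ⁻¹' φ.target
  have hU : IsOpen U := φ.open_target.preimage hℓ.continuous
  have hqU : q.1 ∈ U := by simpa only [U, mem_preimage, hℓq] using hqt
  have hc : ContDiffOn ℝ ∞ c U := hφs.comp hℓ.contDiffOn fun s hs => hs
  have hcq : c q.1 = p := by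
    change φ.symm (ℓ q.1) = p
    rw [hℓq]; exact φ.left_inv hp
  -- the velocity of `c` at `q.1`
  have hφd : DifferentiableAt ℝ φ p :=
    (hφ.contDiffAt (φ.open_source.mem_nhds hp)).differentiableAt hinf
  have hφsd : DifferentiableAt ℝ φ.symm q :=
    (hφs.contDiffAt (φ.open_target.mem_nhds hqt)).differentiableAt hinf
  have hinv := φ.fderiv_symm_comp_fderiv hp hφd hφsd
  have hcd : HasDerivAt c (w.1⁻¹ • ((1, v) : XYZ)) q.1 := by
    have h1 : HasDerivAt c (fderiv ℝ φ.symm q (1, a, b)) q.1 := by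
      have : HasFDerivAt φ.symm (fderiv ℝ φ.symm q) (ℓ q.1) := hℓq.symm ▸ hφsd.hasFDerivAt
      exact this.comp_hasDerivAt q.1 (hℓd q.1)
    have h2 : fderiv ℝ φ.symm q w = (1, v) := DFunLike.congr_fun hinv (1, v)
    rw [hwm, map_smul] at h2
    rwa [← h2, inv_smul_smul₀ hv]
  have hx : ContDiffOn ℝ ∞ (fun s => (c s).1) U := hc.fst
  have hxd : HasDerivAt (fun s => (c s).1) w.1⁻¹ q.1 := by
    simpa using hcd.hasFDerivAt.fst.hasDerivAt
  -- The pulled back line `c` has x-velocity 1 / `w.1` ≠ 0, so near p it can be reparametrized by x.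
  -- The solution with the given 1-jet thus comes from the line, and no existence theorem for f is
  -- needed.
  obtain ⟨e, hex, hqe, heU, hconn, htconn, -, hsymm⟩ :=
    exists_interval_diffeo hU hqU hx (by rw [hxd.deriv]; exact inv_ne_zero hv)
  have hpx : e q.1 = p.1 := by rw [hex]; simp only [hcq]
  have hpt : p.1 ∈ e.target := hpx ▸ e.map_source hqe
  have hT0 : e.symm p.1 = q.1 := by rw [← hpx, e.left_inv hqe]
  let y : ℝ → ℝ := fun x => (c (e.symm x)).2.1
  let z : ℝ → ℝ := fun x => (c (e.symm x)).2.2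
  have hmaps : MapsTo e.symm e.target U := fun x hx => heU (e.map_target hx)
  have hγ : ∀ x ∈ e.target, (x, y x, z x) = c (e.symm x) := fun x hx => by
    refine Prod.ext ?_ rfl
    have := e.right_inv hx
    rw [hex] at this
    exact this.symm
  have hcs : ContDiffOn ℝ ∞ (fun x => c (e.symm x)) e.target := hc.comp hsymm hmaps
  have hy : ContDiffOn ℝ ∞ y e.target := hcs.snd.fst
  have hz : ContDiffOn ℝ ∞ z e.target := hcs.snd.snd
  have hle : (2 : WithTop ℕ∞) ≤ ∞ := by norm_cast
  have hφγ : ∀ x ∈ e.target, φ (x, y x, z x) = ℓ (e.symm x) := fun x hx => by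
    rw [hγ x hx]; exact φ.right_inv (hmaps hx)
  have hsrc : ∀ x ∈ e.target, (x, y x, z x) ∈ φ.source := fun x hx => by
    rw [hγ x hx]; exact φ.map_target (hmaps hx)
  have hline : IsSolutionOn freeParticle e.source Y Z := by
    refine ⟨(hY.of_le hle).contDiffOn, (hZ.of_le hle).contDiffOn, fun s _ => ?_⟩
    have h1 : deriv Y = fun _ => a := funext fun s => (hYd s).deriv
    have h2 : deriv Z = fun _ => b := funext fun s => (hZd s).deriv
    simp [freeParticle, h1, h2]
  have hsol : IsSolutionOn f e.target y z := by
    refine (hT e.target e.source y z Y Z e.open_target htconn e.open_source hconn (hy.of_le hle)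
      (hz.of_le hle) (hY.of_le hle).contDiffOn (hZ.of_le hle).contDiffOn ?_ ?_).2 hline
    · rintro _ ⟨x, hx, rfl⟩
      exact hsrc x hx
    · rw [curveGraph, curveGraph, image_image, ← e.symm_image_target_eq_source, image_image]
      exact image_congr hφγ
  -- derivatives of `y`, `z` and of `e.symm`
  have hdy : ∀ x ∈ e.target, HasDerivAt y (deriv y x) x := fun x hx =>
    ((hy.contDiffAt (e.open_target.mem_nhds hx)).differentiableAt hinf).hasDerivAt
  have hdz : ∀ x ∈ e.target, HasDerivAt z (deriv z x) x := fun x hx =>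
    ((hz.contDiffAt (e.open_target.mem_nhds hx)).differentiableAt hinf).hasDerivAt
  have hde : ∀ x ∈ e.target, HasDerivAt e.symm (deriv e.symm x) x := fun x hx =>
    ((hsymm.contDiffAt (e.open_target.mem_nhds hx)).differentiableAt hinf).hasDerivAt
  have hd2 : ∀ {g : ℝ → ℝ}, ContDiffOn ℝ ∞ g e.target →
      HasDerivAt (deriv g) (deriv (deriv g) p.1) p.1 := fun hg =>
    ((((contDiffOn_infty_iff_deriv_of_isOpen e.open_target).1 hg).2.contDiffAt
      (e.open_target.mem_nhds hpt)).differentiableAt hinf).hasDerivAt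
  let γ : ℝ → XYZ := fun x => (x, y x, z x)
  let γ' : ℝ → XYZ := fun x => (1, deriv y x, deriv z x)
  have hγd : ∀ x ∈ e.target, HasDerivAt γ (γ' x) x := fun x hx =>
    (hasDerivAt_id x).prodMk ((hdy x hx).prodMk (hdz x hx))
  have hγp : γ p.1 = p := by
    change (p.1, y p.1, z p.1) = p
    rw [hγ _ hpt, hT0, hcq]
  have hγ'p : γ' p.1 = (1, v) := by
    have h1 : HasDerivAt γ (deriv e.symm p.1 • w.1⁻¹ • ((1, v) : XYZ)) p.1 := by
      have h2 : HasDerivAt c (w.1⁻¹ • ((1, v) : XYZ)) (e.symm p.1) := hT0.symm ▸ hcd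
      refine (h2.scomp p.1 (hde _ hpt)).congr_of_eventuallyEq ?_
      filter_upwards [e.open_target.mem_nhds hpt] with x hx using hγ x hx
    have h2 := (hγd _ hpt).unique h1
    have h3 := congrArg Prod.fst h2
    simp only [Prod.smul_fst, γ', smul_eq_mul, mul_one] at h3
    rw [h2, smul_smul, ← h3, one_smul]
  have hγ''p : HasDerivAt γ' (0, -f p v) p.1 := by
    obtain ⟨-, -, hs⟩ := hsol
    obtain ⟨h1, h2⟩ := hs _ hpt
    have h3 : (p.1, y p.1, z p.1) = p := hγp
    have h4 : (deriv y p.1, deriv z p.1) = v := congrArg Prod.snd hγ'p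
    rw [h3, h4] at h1 h2
    have h5 : (0, -f p v) = ((0, deriv (deriv y) p.1, deriv (deriv z) p.1) : XYZ) := by
      ext <;> simp <;> linarith
    rw [h5]
    exact (hasDerivAt_const _ _).prodMk ((hd2 hy).prodMk (hd2 hz))
  -- The right side keeps the fixed direction (1, a, b), so differentiating once more at p gives a
  -- multiple of w.
  have hD : ∀ x ∈ e.target, fderiv ℝ φ (γ x) (γ' x) = deriv e.symm x • ((1, a, b) : XYZ) := by
    intro x hx
    have h1 := (((hφ.contDiffAt (φ.open_source.mem_nhds (hsrc x hx))).differentiableAt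
      hinf).hasFDerivAt).comp_hasDerivAt x (hγd x hx)
    have h2 := (hℓd (e.symm x)).scomp x (hde x hx)
    refine h1.unique (h2.congr_of_eventuallyEq ?_)
    filter_upwards [e.open_target.mem_nhds hx] with x hx using hφγ x hx
  have hDφ : HasFDerivAt (fderiv ℝ φ) (fderiv ℝ (fderiv ℝ φ) p) (γ p.1) := by
    rw [hγp]
    exact ((((contDiffOn_infty_iff_fderiv_of_isOpen φ.open_source).1 hφ).2.contDiffAt
      (φ.open_source.mem_nhds hp)).differentiableAt hinf).hasFDerivAt
  have hl := (hDφ.comp_hasDerivAt p.1 (hγd _ hpt)).clm_apply hγ''p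
  have hr : HasDerivAt (fun x => fderiv ℝ φ (γ x) (γ' x))
      (deriv (deriv e.symm) p.1 • ((1, a, b) : XYZ)) p.1 := by
    refine ((hd2 hsymm).smul_const _).congr_of_eventuallyEq ?_
    filter_upwards [e.open_target.mem_nhds hpt] with x hx using hD x hx
  have hfin := hl.unique hr
  refine ⟨deriv (deriv e.symm) p.1 * w.1⁻¹, ?_⟩
  simp only [Function.comp_apply, hγp, hγ'p] at hfin
  rw [hfin, mul_smul]
  congr 1
  conv_rhs => rw [hwm]
  simp only [smul_smul]
  simp [hv]

/-! ### Necessity: the Hessian of a straightening map -/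

/-- The coordinate vector field along `x`. -/
def unitX : XYZ := (1, 0, 0)

/-- The coordinate vector field along `y`. -/
def unitY : XYZ := (0, 1, 0)

/-- The coordinate vector field along `z`. -/
def unitZ : XYZ := (0, 0, 1)

theorem xyz_eq_smul (r : XYZ) : r = r.1 • unitX + r.2.1 • unitY + r.2.2 • unitZ := by
  ext <;> simp [unitX, unitY, unitZ]

theorem cubic_coeff_eq_zero {a₀ a₁ a₂ a₃ a₄ a₅ a₆ a₇ a₈ a₉ : ℝ}
    (h : ∀ s t : ℝ, a₀ + a₁ * s + a₂ * t + a₃ * s ^ 2 + a₄ * s * t + a₅ * t ^ 2 + a₆ * s ^ 3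
      + a₇ * s ^ 2 * t + a₈ * s * t ^ 2 + a₉ * t ^ 3 = 0) :
    a₀ = 0 ∧ a₁ = 0 ∧ a₂ = 0 ∧ a₃ = 0 ∧ a₄ = 0 ∧ a₅ = 0 ∧ a₆ = 0 ∧ a₇ = 0 ∧ a₈ = 0 ∧ a₉ = 0 := by
  have h1 := h 0 0
  have h2 := h 1 0
  have h3 := h (-1) 0
  have h4 := h 2 0
  have h5 := h 0 1
  have h6 := h 0 (-1)
  have h7 := h 0 2
  have h8 := h 1 1
  have h9 := h 1 (-1)
  have h10 := h (-1) 1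
  refine ⟨?_, ?_, ?_, ?_, ?_, ?_, ?_, ?_, ?_, ?_⟩ <;> linarith

open Topology Filter in
/-- The right-hand side of a system that a point transformation `φ` straightens is determined by
the pulled back flat connection. -/
theorem Transforms.eq_of_fderiv {φ : OpenPartialHomeomorph XYZ XYZ}
    {f : SecondOrderSystem} (hφ : ContDiffOn ℝ ∞ φ φ.source)
    (hφs : ContDiffOn ℝ ∞ φ.symm φ.target) (hT : Transforms φ f freeParticle)
    {p : XYZ} (hp : p ∈ φ.source) (hf : Continuous (f p)) (v : ℝ × ℝ) :
    f p v = (fderiv ℝ φ.symm (φ p) (fderiv ℝ (fderiv ℝ φ) p (1, v) (1, v))).2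
      - (fderiv ℝ φ.symm (φ p) (fderiv ℝ (fderiv ℝ φ) p (1, v) (1, v))).1 • v := by
  have hinf : (∞ : WithTop ℕ∞) ≠ 0 := by simp
  have hφd : DifferentiableAt ℝ φ p :=
    (hφ.contDiffAt (φ.open_source.mem_nhds hp)).differentiableAt hinf
  have hφsd : DifferentiableAt ℝ φ.symm (φ p) :=
    (hφs.contDiffAt (φ.open_target.mem_nhds (φ.map_source hp))).differentiableAt hinf
  have hinv := φ.fderiv_symm_comp_fderiv hp hφd hφsd
  have hinv' := φ.symm.fderiv_symm_comp_fderiv (φ.map_source hp) hφsd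
    (by rw [φ.left_inv hp]; exact hφd)
  rw [φ.left_inv hp] at hinv'
  let b : ℝ × ℝ → XYZ := fun v => fderiv ℝ φ.symm (φ p) (fderiv ℝ (fderiv ℝ φ) p (1, v) (1, v))
  -- The parallelism reads b(v) = μ(1, v) − (0, −f); its x-component gives μ, whence g(v) = 0.
  -- Velocities whose image is vertical are reached by continuity along a line in v.
  let g : ℝ × ℝ → ℝ × ℝ := fun v => (b v).2 - (b v).1 • v - f p v
  have hb : Continuous b := by fun_prop
  have hg : Continuous g := by fun_prop
  have hgen : ∀ v : ℝ × ℝ, (fderiv ℝ φ p (1, v)).1 ≠ 0 → g v = 0 := by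
    intro v hv
    obtain ⟨μ, hμ⟩ := hT.exists_second_deriv_parallel hφ hφs hp hv
    have h1 := congrArg (fderiv ℝ φ.symm (φ p)) hμ
    have h2 : ∀ r, fderiv ℝ φ.symm (φ p) (fderiv ℝ φ p r) = r := DFunLike.congr_fun hinv
    rw [map_add, map_smul, h2, h2] at h1
    have h3 : b v = μ • ((1, v) : XYZ) - (0, -f p v) := eq_sub_of_add_eq h1
    ext <;> simp [g, h3]
  suffices h : g v = 0 from (sub_eq_zero.1 h).symm
  by_cases hv : (fderiv ℝ φ p (1, v)).1 = 0
  -- If every velocity had a vertical image, the vectors (1, v) would span and Dφ would not be onto.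
  · obtain ⟨d, hd⟩ : ∃ d : ℝ × ℝ, (fderiv ℝ φ p (1, v + d)).1 ≠ 0 := by
      by_contra! hall
      have h1 : ∀ d : ℝ × ℝ, (fderiv ℝ φ p (0, d)).1 = 0 := fun d => by
        have h2 : ((0, d) : XYZ) = (1, v + d) - (1, v) := by simp
        rw [h2, map_sub, Prod.fst_sub, hall d, hv, sub_zero]
      have h3 : ∀ r : XYZ, (fderiv ℝ φ p r).1 = 0 := fun r => by
        have h2 : r = r.1 • ((1, v) : XYZ) + (0, r.2 - r.1 • v) := by ext <;> simp
        rw [h2, map_add, map_smul, Prod.fst_add, Prod.smul_fst, hv, h1]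
        simp
      have h4 := h3 (fderiv ℝ φ.symm (φ p) (1, 0))
      have h5 : ∀ r, fderiv ℝ φ p (fderiv ℝ φ.symm (φ p) r) = r := DFunLike.congr_fun hinv'
      rw [h5] at h4
      exact one_ne_zero h4
    have hline : ∀ t : ℝ, t ≠ 0 → g (v + t • d) = 0 := fun t ht => hgen _ <| by
      have h1 : ((1, v + t • d) : XYZ) = (1, v) + t • ((1, v + d) - (1, v)) := by
        ext <;> simp
      rw [h1, map_add, map_smul, map_sub, Prod.fst_add, Prod.smul_fst, Prod.fst_sub, hv]
      simpa using ⟨ht, hd⟩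
    have hc : Continuous fun t : ℝ => g (v + t • d) := by fun_prop
    have h1 : Tendsto (fun t : ℝ => g (v + t • d)) (𝓝[≠] 0) (𝓝 (g (v + (0 : ℝ) • d))) :=
      (hc.tendsto 0).mono_left nhdsWithin_le_nhds
    have h2 : Tendsto (fun t : ℝ => g (v + t • d)) (𝓝[≠] 0) (𝓝 0) :=
      tendsto_const_nhds.congr' <| by
        filter_upwards [self_mem_nhdsWithin] with t ht using (hline t ht).symm
    simpa using tendsto_nhds_unique h1 h2
  · exact hgen v hv

/-- The Hessian of a point transformation that straightens a system linear in the first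
derivatives: the pulled back flat connection is projectively equivalent to the connection of the
system. -/
theorem Transforms.exists_hessian {φ : OpenPartialHomeomorph XYZ XYZ}
    {C22 C23 C32 C33 : ℝ → ℝ} {D2 D3 : XYZ → ℝ} (hφ : ContDiffOn ℝ ∞ φ φ.source)
    (hφs : ContDiffOn ℝ ∞ φ.symm φ.target)
    (hT : Transforms φ (linearInDerivatives C22 C23 C32 C33 D2 D3) freeParticle) :
    ∃ ψ₁ ψ₂ ψ₃ : XYZ → ℝ, (∀ p ∈ φ.source, DifferentiableAt ℝ ψ₁ p ∧ DifferentiableAt ℝ ψ₂ p ∧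
        DifferentiableAt ℝ ψ₃ p) ∧ ∀ p ∈ φ.source,
      fderiv ℝ (fderiv ℝ φ) p unitX unitX = (2 * ψ₁ p) • fderiv ℝ φ p unitX
        + D2 p • fderiv ℝ φ p unitY + D3 p • fderiv ℝ φ p unitZ ∧
      fderiv ℝ (fderiv ℝ φ) p unitX unitY = ψ₂ p • fderiv ℝ φ p unitX
        + (1 / 2 * C22 p.1 + ψ₁ p) • fderiv ℝ φ p unitY + (1 / 2 * C32 p.1) • fderiv ℝ φ p unitZ ∧
      fderiv ℝ (fderiv ℝ φ) p unitX unitZ = ψ₃ p • fderiv ℝ φ p unitX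
        + (1 / 2 * C23 p.1) • fderiv ℝ φ p unitY + (1 / 2 * C33 p.1 + ψ₁ p) • fderiv ℝ φ p unitZ ∧
      fderiv ℝ (fderiv ℝ φ) p unitY unitY = (2 * ψ₂ p) • fderiv ℝ φ p unitY ∧
      fderiv ℝ (fderiv ℝ φ) p unitY unitZ = ψ₃ p • fderiv ℝ φ p unitY
        + ψ₂ p • fderiv ℝ φ p unitZ ∧
      fderiv ℝ (fderiv ℝ φ) p unitZ unitZ = (2 * ψ₃ p) • fderiv ℝ φ p unitZ := by
  have hinf : (∞ : WithTop ℕ∞) ≠ 0 := by simp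
  -- The components of B are the Christoffel symbols of the pulled back flat connection.
  let B : XYZ → XYZ → XYZ → XYZ := fun p r s =>
    fderiv ℝ φ.symm (φ p) (fderiv ℝ (fderiv ℝ φ) p r s)
  have hB : ∀ p ∈ φ.source, ∀ r s, DifferentiableAt ℝ (fun p => B p r s) p := by
    intro p hp r s
    have hn := φ.open_source.mem_nhds hp
    have hnt := φ.open_target.mem_nhds (φ.map_source hp)
    have h0 := ((contDiffOn_infty_iff_fderiv_of_isOpen φ.open_source).1 hφ).2
    have h1 := ((contDiffOn_infty_iff_fderiv_of_isOpen φ.open_source).1 h0).2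
    have h2 := ((contDiffOn_infty_iff_fderiv_of_isOpen φ.open_target).1 hφs).2
    have h3 : DifferentiableAt ℝ (fun p => fderiv ℝ φ.symm (φ p)) p :=
      ((h2.contDiffAt hnt).differentiableAt hinf).comp p
        ((hφ.contDiffAt hn).differentiableAt hinf)
    have h4 := (h1.contDiffAt hn).differentiableAt hinf
    exact h3.clm_apply ((h4.clm_apply (differentiableAt_const r)).clm_apply
      (differentiableAt_const s))
  -- The x-components of B multiply v in `Transforms.eq_of_fderiv`; comparing coefficients ties the
  -- remaining components to these three.
  refine ⟨fun p => 1 / 2 * (B p unitX unitX).1, fun p => (B p unitX unitY).1,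
    fun p => (B p unitX unitZ).1, fun p hp => ⟨(hB p hp _ _).fst.const_mul _, (hB p hp _ _).fst,
      (hB p hp _ _).fst⟩, fun p hp => ?_⟩
  have hφp := hφ.contDiffAt (φ.open_source.mem_nhds hp)
  have hφd : DifferentiableAt ℝ φ p := hφp.differentiableAt hinf
  have hφsd : DifferentiableAt ℝ φ.symm (φ p) :=
    (hφs.contDiffAt (φ.open_target.mem_nhds (φ.map_source hp))).differentiableAt hinf
  have hinv := φ.symm.fderiv_symm_comp_fderiv (φ.map_source hp) hφsd
    (by rw [φ.left_inv hp]; exact hφd)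
  rw [φ.left_inv hp] at hinv
  have hBH : ∀ r s, fderiv ℝ (fderiv ℝ φ) p r s = (B p r s).1 • fderiv ℝ φ p unitX
      + (B p r s).2.1 • fderiv ℝ φ p unitY + (B p r s).2.2 • fderiv ℝ φ p unitZ := by
    intro r s
    rw [← map_smul, ← map_smul, ← map_smul, ← map_add, ← map_add, ← xyz_eq_smul]
    exact (DFunLike.congr_fun hinv _).symm
  have hsymm : ∀ r s, B p r s = B p s r := fun r s => by
    simp only [B]
    rw [(hφp.isSymmSndFDerivAt (by rw [minSmoothness_of_isRCLikeNormedField]; norm_cast)).eq r s]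
  have hquad : ∀ s t : ℝ, B p (1, s, t) (1, s, t) = B p unitX unitX + s ^ 2 • B p unitY unitY
      + t ^ 2 • B p unitZ unitZ + (2 * s) • B p unitX unitY + (2 * t) • B p unitX unitZ
      + (2 * s * t) • B p unitY unitZ := by
    intro s t
    have h1 : ((1, s, t) : XYZ) = unitX + s • unitY + t • unitZ := by
      ext <;> simp [unitX, unitY, unitZ]
    have h2 : ∀ a b c, B p (a + b) c = B p a c + B p b c := fun a b c => by simp [B]
    have h3 : ∀ a b c, B p a (b + c) = B p a b + B p a c := fun a b c => by simp [B]
    have h4 : ∀ (k : ℝ) a b, B p (k • a) b = k • B p a b := fun a b c => by simp [B]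
    have h5 : ∀ (k : ℝ) a b, B p a (k • b) = k • B p a b := fun a b c => by simp [B]
    rw [h1]
    simp only [h2, h3, h4, h5, hsymm unitY unitX, hsymm unitZ unitX, hsymm unitZ unitY]
    module
  have key : ∀ s t : ℝ, _ := fun s t => hT.eq_of_fderiv hφ hφs hp
    (by unfold linearInDerivatives; fun_prop) (s, t)
  have key1 : ∀ s t : ℝ, C22 p.1 * s + C23 p.1 * t + D2 p
      = (B p (1, s, t) (1, s, t)).2.1 - (B p (1, s, t) (1, s, t)).1 * s :=
    fun s t => congrArg Prod.fst (key s t)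
  have key2 : ∀ s t : ℝ, C32 p.1 * s + C33 p.1 * t + D3 p
      = (B p (1, s, t) (1, s, t)).2.2 - (B p (1, s, t) (1, s, t)).1 * t :=
    fun s t => congrArg Prod.snd (key s t)
  simp only [hquad, Prod.fst_add, Prod.snd_add, Prod.smul_fst, Prod.smul_snd, smul_eq_mul]
    at key1 key2
  rw [hBH unitX unitX, hBH unitX unitY, hBH unitX unitZ, hBH unitY unitY, hBH unitY unitZ,
    hBH unitZ unitZ]
  obtain ⟨e1, e2, e3, e4, e5, e6, e7, e8, e9, -⟩ := cubic_coeff_eq_zero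
    (a₀ := (B p unitX unitX).2.1 - D2 p)
    (a₁ := 2 * (B p unitX unitY).2.1 - C22 p.1 - (B p unitX unitX).1)
    (a₂ := 2 * (B p unitX unitZ).2.1 - C23 p.1)
    (a₃ := (B p unitY unitY).2.1 - 2 * (B p unitX unitY).1)
    (a₄ := 2 * (B p unitY unitZ).2.1 - 2 * (B p unitX unitZ).1)
    (a₅ := (B p unitZ unitZ).2.1) (a₆ := -(B p unitY unitY).1)
    (a₇ := -2 * (B p unitY unitZ).1) (a₈ := -(B p unitZ unitZ).1) (a₉ := 0)
    fun s t => by linear_combination -key1 s t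
  obtain ⟨g1, g2, g3, g4, g5, g6, -⟩ := cubic_coeff_eq_zero
    (a₀ := (B p unitX unitX).2.2 - D3 p)
    (a₁ := 2 * (B p unitX unitY).2.2 - C32 p.1)
    (a₂ := 2 * (B p unitX unitZ).2.2 - C33 p.1 - (B p unitX unitX).1)
    (a₃ := (B p unitY unitY).2.2)
    (a₄ := 2 * (B p unitY unitZ).2.2 - 2 * (B p unitX unitY).1)
    (a₅ := (B p unitZ unitZ).2.2 - 2 * (B p unitX unitZ).1) (a₆ := 0)
    (a₇ := -(B p unitY unitY).1) (a₈ := -2 * (B p unitY unitZ).1) (a₉ := -(B p unitZ unitZ).1)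
    fun s t => by linear_combination -key2 s t
  refine ⟨?_, ?_, ?_, ?_, ?_, ?_⟩ <;> match_scalars <;> linarith

/-! ### Necessity: integrability conditions -/

/-- The Jacobi endomorphism of a straightenable system is a multiple of the identity. -/
theorem Transforms.partial_eq {φ : OpenPartialHomeomorph XYZ XYZ}
    {C22 C23 C32 C33 : ℝ → ℝ} {D2 D3 : XYZ → ℝ} (hφ : ContDiffOn ℝ ∞ φ φ.source)
    (hφs : ContDiffOn ℝ ∞ φ.symm φ.target)
    (hT : Transforms φ (linearInDerivatives C22 C23 C32 C33 D2 D3) freeParticle)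
    {p : XYZ} (hp : p ∈ φ.source)
    (h22 : DifferentiableAt ℝ C22 p.1) (h23 : DifferentiableAt ℝ C23 p.1)
    (h32 : DifferentiableAt ℝ C32 p.1) (h33 : DifferentiableAt ℝ C33 p.1)
    (hD2 : DifferentiableAt ℝ D2 p) (hD3 : DifferentiableAt ℝ D3 p) :
    1 / 2 * deriv C32 p.1 + 1 / 4 * C33 p.1 * C32 p.1 + 1 / 4 * C22 p.1 * C32 p.1
        = fderiv ℝ D3 p unitY ∧
    1 / 2 * deriv C23 p.1 + 1 / 4 * C23 p.1 * C33 p.1 + 1 / 4 * C23 p.1 * C22 p.1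
        = fderiv ℝ D2 p unitZ ∧
    1 / 2 * deriv C33 p.1 - 1 / 2 * deriv C22 p.1
        + 1 / 4 * C33 p.1 * C33 p.1 - 1 / 4 * C22 p.1 * C22 p.1
        = fderiv ℝ D3 p unitZ - fderiv ℝ D2 p unitY := by
  have hinf : (∞ : WithTop ℕ∞) ≠ 0 := by simp
  obtain ⟨ψ₁, ψ₂, ψ₃, hψ, hH⟩ := hT.exists_hessian hφ hφs
  have hn := φ.open_source.mem_nhds hp
  have hφp := hφ.contDiffAt hn
  have hφd : DifferentiableAt ℝ φ p := hφp.differentiableAt hinf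
  have hφsd : DifferentiableAt ℝ φ.symm (φ p) :=
    (hφs.contDiffAt (φ.open_target.mem_nhds (φ.map_source hp))).differentiableAt hinf
  have hinv : ∀ r, fderiv ℝ φ.symm (φ p) (fderiv ℝ φ p r) = r :=
    DFunLike.congr_fun (φ.fderiv_symm_comp_fderiv hp hφd hφsd)
  have hd1 := ((contDiffOn_infty_iff_fderiv_of_isOpen φ.open_source).1 hφ).2
  have hd2 := ((contDiffOn_infty_iff_fderiv_of_isOpen φ.open_source).1 hd1).2
  have hdd : DifferentiableAt ℝ (fderiv ℝ φ) p := (hd1.contDiffAt hn).differentiableAt hinf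
  have hddd := (hd2.contDiffAt hn).differentiableAt hinf
  obtain ⟨hψ₁, hψ₂, hψ₃⟩ := hψ p hp
  have hfr : ∀ r : XYZ, HasFDerivAt (fun p => fderiv ℝ φ p r)
      ((fderiv ℝ (fderiv ℝ φ) p).flip r) p := fun r => by
    simpa using hdd.hasFDerivAt.clm_apply (hasFDerivAt_const r p)
  have hsymm : ∀ p' ∈ φ.source, ∀ r s, fderiv ℝ (fderiv ℝ φ) p' r s
      = fderiv ℝ (fderiv ℝ φ) p' s r := fun p' hp' r s =>
    ((hφ.contDiffAt (φ.open_source.mem_nhds hp')).isSymmSndFDerivAt (by rw [minSmoothness_of_isRCLikeNormedField]; norm_cast)).eq r s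
  -- third derivatives commute
  have hthird : ∀ r : XYZ, fderiv ℝ (fderiv ℝ (fderiv ℝ φ)) p r unitX unitX
      = fderiv ℝ (fderiv ℝ (fderiv ℝ φ)) p unitX unitX r := by
    -- This is the symmetry of the second derivative of the single map p ↦ Dφ(p)(`unitX`), combined
    -- with the symmetry of D²φ at nearby points.
    intro r
    have h1 : fderiv ℝ (fun p => fderiv ℝ φ p unitX)
        =ᶠ[nhds p] fun p => fderiv ℝ (fderiv ℝ φ) p unitX := by
      filter_upwards [hn] with p' hp'
      refine ContinuousLinearMap.ext fun s => ?_
      have hd := ((hd1.contDiffAt (φ.open_source.mem_nhds hp')).differentiableAt hinf).hasFDerivAt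
      rw [(hd.clm_apply (hasFDerivAt_const unitX p')).fderiv]
      simpa using hsymm p' hp' s unitX
    have h2 : ∀ s, fderiv ℝ (fderiv ℝ (fun p => fderiv ℝ φ p unitX)) p s
        = fderiv ℝ (fderiv ℝ (fderiv ℝ φ)) p s unitX := fun s => by
      rw [h1.fderiv_eq, (hddd.hasFDerivAt.clm_apply (hasFDerivAt_const unitX p)).fderiv]
      simp
    have h3 : ContDiffAt ℝ ∞ (fun p => fderiv ℝ φ p unitX) p :=
      (hd1.contDiffAt hn).clm_apply contDiffAt_const
    rw [← h2, ← h2]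
    exact (h3.isSymmSndFDerivAt (by rw [minSmoothness_of_isRCLikeNormedField]; norm_cast)).eq r unitX
  have hval : ∀ {r s : XYZ} {g : XYZ → XYZ} {g' : XYZ →L[ℝ] XYZ},
      (∀ p ∈ φ.source, fderiv ℝ (fderiv ℝ φ) p r s = g p) → HasFDerivAt g g' p →
      ∀ t, fderiv ℝ (fderiv ℝ (fderiv ℝ φ)) p t r s = g' t := by
    intro r s g g' hg hg' t
    have h1 := (hddd.hasFDerivAt.clm_apply (hasFDerivAt_const r p)).clm_apply
      (hasFDerivAt_const s p)
    have h2 : (fun p => fderiv ℝ (fderiv ℝ φ) p r s) =ᶠ[nhds p] g := by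
      filter_upwards [hn] with p' hp' using hg p' hp'
    rw [← h1.unique (hg'.congr_of_eventuallyEq h2)]
    simp
  have hfst : ∀ {g : ℝ → ℝ}, DifferentiableAt ℝ g p.1 →
      HasFDerivAt (fun p : XYZ => 1 / 2 * g p.1)
        ((1 / 2 : ℝ) • deriv g p.1 • ContinuousLinearMap.fst ℝ ℝ (ℝ × ℝ)) p :=
    fun hg => (hg.hasDerivAt.comp_hasFDerivAt p hasFDerivAt_fst).const_mul _
  have G11 := hval (fun p hp => (hH p hp).1) (((((hψ₁.hasFDerivAt.const_mul 2).smul (hfr unitX)).add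
    (hD2.hasFDerivAt.smul (hfr unitY))).add (hD3.hasFDerivAt.smul (hfr unitZ))))
  have G12 := hval (fun p hp => (hH p hp).2.1) ((((hψ₂.hasFDerivAt).smul (hfr unitX)).add
    (((hfst h22).add hψ₁.hasFDerivAt).smul (hfr unitY))).add
      ((hfst h32).smul (hfr unitZ))) unitX
  have G13 := hval (fun p hp => (hH p hp).2.2.1) ((((hψ₃.hasFDerivAt).smul (hfr unitX)).add
    ((hfst h23).smul (hfr unitY))).add
      (((hfst h33).add hψ₁.hasFDerivAt).smul (hfr unitZ))) unitX
  obtain ⟨H11, H12, H13, H22, H23, H33⟩ := hH p hp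
  -- φ_xxy = φ_xyx and φ_xxz = φ_xzx, each side computed by differentiating the Hessian formulas.
  -- These formulas are then substituted again, and (Dφ)⁻¹ turns the result into an equation between
  -- coefficients.
  have EY := (G11 unitY).symm.trans ((hthird unitY).trans G12)
  have EZ := (G11 unitZ).symm.trans ((hthird unitZ).trans G13)
  simp only [add_apply, smul_apply,
    ContinuousLinearMap.flip_apply, ContinuousLinearMap.smulRight_apply,
    ContinuousLinearMap.coe_fst', hsymm p hp unitY unitX, hsymm p hp unitZ unitX,
    hsymm p hp unitZ unitY, H11, H12, H13, H22, H23, H33] at EY EZ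
  replace EY := congrArg (fderiv ℝ φ.symm (φ p)) EY
  replace EZ := congrArg (fderiv ℝ φ.symm (φ p)) EZ
  simp only [map_add, map_smul, hinv] at EY EZ
  have Y2 := congrArg (fun r : XYZ => r.2.1) EY
  have Y3 := congrArg (fun r : XYZ => r.2.2) EY
  have Z2 := congrArg (fun r : XYZ => r.2.1) EZ
  have Z3 := congrArg (fun r : XYZ => r.2.2) EZ
  simp [unitX, unitY, unitZ] at Y2 Y3 Z2 Z3
  simp only [unitY, unitZ]
  -- Both `Y2` and `Z3` contain ∂ₓψ₁ − ψ₁² − ψ₂`D2` − ψ₃`D3`, which cancels in their difference; in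
  -- `Y3` and `Z2` all ψ-terms cancel.
  refine ⟨?_, ?_, ?_⟩
  · linear_combination -Y3
  · linear_combination -Z2
  · linear_combination Y2 - Z3

/-! ### Sufficiency: change of variables and affine dependence -/

theorem ContDiffOn.hasDerivAt_deriv_deriv {g : ℝ → ℝ} {J : Set ℝ} (hg : ContDiffOn ℝ 2 g J)
    (hJ : IsOpen J) {x : ℝ} (hx : x ∈ J) :
    HasDerivAt g (deriv g x) x ∧ HasDerivAt (deriv g) (deriv (deriv g) x) x := by
  have h := hJ.mem_nhds hx
  have hg' : ContDiffOn ℝ 1 (deriv g) J :=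
    ((contDiffOn_succ_iff_deriv_of_isOpen hJ).1 (by simpa [one_add_one_eq_two] using hg)).2.2
  exact ⟨((hg.contDiffAt h).differentiableAt two_ne_zero).hasDerivAt,
    ((hg'.contDiffAt h).differentiableAt one_ne_zero).hasDerivAt⟩

open Topology in
/-- The second derivative, with respect to the new independent variable `X` with `X' = 1 / s ^ 2`,
of the new dependent variable `(q₁ h₁ + q₂ h₂) / s`. -/
theorem deriv_deriv_eq_of_reparam {J : Set ℝ} (hJ : IsOpen J)
    {Y X s s₁ lam q₁ q₂ a b c d h₁ h₂ : ℝ → ℝ}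
    (hs : ∀ x ∈ J, HasDerivAt s (s₁ x) x) (hs₁ : ∀ x ∈ J, HasDerivAt s₁ (-(lam x * s x)) x)
    (hs₀ : ∀ x ∈ J, s x ≠ 0) (hX : ∀ x ∈ J, HasDerivAt X (1 / s x ^ 2) x)
    (hq₁ : ∀ x ∈ J, HasDerivAt q₁ (1 / 2 * (q₁ x * a x + q₂ x * c x)) x)
    (hq₂ : ∀ x ∈ J, HasDerivAt q₂ (1 / 2 * (q₁ x * b x + q₂ x * d x)) x)
    (ha : ∀ x ∈ J, DifferentiableAt ℝ a x) (hb : ∀ x ∈ J, DifferentiableAt ℝ b x)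
    (hc : ∀ x ∈ J, DifferentiableAt ℝ c x) (hd : ∀ x ∈ J, DifferentiableAt ℝ d x)
    (hh₁ : ContDiffOn ℝ 2 h₁ J) (hh₂ : ContDiffOn ℝ 2 h₂ J)
    (hY : ∀ x ∈ J, HasDerivAt Y (deriv Y (X x)) (X x))
    (hY' : ∀ x ∈ J, HasDerivAt (deriv Y) (deriv (deriv Y) (X x)) (X x))
    (hYX : ∀ x ∈ J, Y (X x) = (q₁ x * h₁ x + q₂ x * h₂ x) / s x) {x : ℝ} (hx : x ∈ J) :
    deriv (deriv Y) (X x) = s x ^ 3 *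
      (q₁ x * (deriv (deriv h₁) x + a x * deriv h₁ x + b x * deriv h₂ x
          + (1 / 2 * deriv a x + 1 / 4 * (a x * a x + b x * c x) + lam x) * h₁ x
          + (1 / 2 * deriv b x + 1 / 4 * (a x * b x + b x * d x)) * h₂ x)
        + q₂ x * (deriv (deriv h₂) x + c x * deriv h₁ x + d x * deriv h₂ x
          + (1 / 2 * deriv c x + 1 / 4 * (c x * a x + d x * c x)) * h₁ x
          + (1 / 2 * deriv d x + 1 / 4 * (c x * b x + d x * d x) + lam x) * h₂ x)) := by
  let g : ℝ → ℝ := fun x => q₁ x * h₁ x + q₂ x * h₂ x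
  let g₁ : ℝ → ℝ := fun x => 1 / 2 * (q₁ x * a x + q₂ x * c x) * h₁ x + q₁ x * deriv h₁ x
    + (1 / 2 * (q₁ x * b x + q₂ x * d x) * h₂ x + q₂ x * deriv h₂ x)
  have hg : ∀ x ∈ J, HasDerivAt g (g₁ x) x := fun x hx =>
    ((hq₁ x hx).mul (hh₁.hasDerivAt_deriv_deriv hJ hx).1).add
      ((hq₂ x hx).mul (hh₂.hasDerivAt_deriv_deriv hJ hx).1)
  -- Y_X = s²(g/s)' is the Wronskian of s and g. In its derivative the products of first derivatives
  -- cancel, leaving s(g'' + λg).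
  have hY1 : ∀ x ∈ J, deriv Y (X x) = s x * g₁ x - s₁ x * g x := by
    intro x hx
    have h1 := (hY x hx).comp x (hX x hx)
    have h2 := ((hg x hx).div (hs x hx) (hs₀ x hx)).congr_of_eventuallyEq
      (show Y ∘ X =ᶠ[𝓝 x] _ by
        filter_upwards [hJ.mem_nhds hx] with t ht using hYX t ht)
    have h3 := h1.unique h2
    have h4 := hs₀ x hx
    field_simp at h3
    linarith
  have h1 := (hY' x hx).comp x (hX x hx)
  obtain ⟨d1, d1'⟩ := hh₁.hasDerivAt_deriv_deriv hJ hx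
  obtain ⟨d2, d2'⟩ := hh₂.hasDerivAt_deriv_deriv hJ hx
  have hg₁ := ((((((hq₁ x hx).mul (ha x hx).hasDerivAt).add ((hq₂ x hx).mul
    (hc x hx).hasDerivAt)).const_mul (1 / 2)).mul d1).add ((hq₁ x hx).mul d1')).add
    ((((((hq₁ x hx).mul (hb x hx).hasDerivAt).add ((hq₂ x hx).mul
    (hd x hx).hasDerivAt)).const_mul (1 / 2)).mul d2).add ((hq₂ x hx).mul d2'))
  have h2 := (((hs x hx).mul hg₁).sub ((hs₁ x hx).mul (hg x hx))).congr_of_eventuallyEq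
    (show deriv Y ∘ X =ᶠ[𝓝 x] _ by
      filter_upwards [hJ.mem_nhds hx] with t ht using hY1 t ht)
  have h3 := h1.unique h2
  have h4 := hs₀ x hx
  simp only [Pi.add_apply, Pi.mul_apply, g, g₁] at h3
  rw [mul_one_div, div_eq_iff (pow_ne_zero 2 h4)] at h3
  rw [h3]
  ring

/-- A function with constant derivative on an interval is affine there. -/
theorem eq_add_mul_of_deriv_eq {g : ℝ → ℝ} {a ε k : ℝ}
    (hg : ∀ t ∈ Metric.ball a ε, DifferentiableAt ℝ g t)
    (hk : ∀ t ∈ Metric.ball a ε, deriv g t = k) {t : ℝ} (ht : t ∈ Metric.ball a ε) :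
    g t = g a + k * (t - a) := by
  have hε : a ∈ Metric.ball a ε := Metric.mem_ball_self (dist_nonneg.trans_lt ht)
  have hd : ∀ t ∈ Metric.ball a ε, HasDerivAt (fun t => g t - k * t) 0 t := fun t ht => by
    have h1 := (hg t ht).hasDerivAt.sub ((hasDerivAt_id t).const_mul k)
    rw [hk t ht, mul_one, sub_self] at h1
    exact h1
  have := Metric.isOpen_ball.is_const_of_deriv_eq_zero (convex_ball a ε).isPreconnected
    (fun t ht => (hd t ht).differentiableAt.differentiableWithinAt)
    (fun t ht => (hd t ht).deriv) ht hε
  linarith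

open Topology in
/-- If `∂D₂/∂z`, `∂D₃/∂y` and `∂D₃/∂z - ∂D₂/∂y` are constant on a square, then `(D₂, D₃)` is
affine there. -/
theorem eq_affine_of_deriv_eq {D₂ D₃ : ℝ → ℝ → ℝ} {y₀ z₀ ε k₂ k₃ k : ℝ}
    (hd₂y : ∀ y ∈ Metric.ball y₀ ε, ∀ z ∈ Metric.ball z₀ ε, DifferentiableAt ℝ (fun t => D₂ t z) y)
    (hd₂z : ∀ y ∈ Metric.ball y₀ ε, ∀ z ∈ Metric.ball z₀ ε, DifferentiableAt ℝ (D₂ y) z)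
    (hd₃y : ∀ y ∈ Metric.ball y₀ ε, ∀ z ∈ Metric.ball z₀ ε, DifferentiableAt ℝ (fun t => D₃ t z) y)
    (hd₃z : ∀ y ∈ Metric.ball y₀ ε, ∀ z ∈ Metric.ball z₀ ε, DifferentiableAt ℝ (D₃ y) z)
    (h₃ : ∀ y ∈ Metric.ball y₀ ε, ∀ z ∈ Metric.ball z₀ ε, deriv (fun t => D₃ t z) y = k₃)
    (h₂ : ∀ y ∈ Metric.ball y₀ ε, ∀ z ∈ Metric.ball z₀ ε, deriv (D₂ y) z = k₂)
    (h : ∀ y ∈ Metric.ball y₀ ε, ∀ z ∈ Metric.ball z₀ ε,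
      deriv (D₃ y) z - deriv (fun t => D₂ t z) y = k)
    {y z : ℝ} (hy : y ∈ Metric.ball y₀ ε) (hz : z ∈ Metric.ball z₀ ε) :
    D₂ y z = D₂ y₀ z₀ + deriv (fun t => D₂ t z₀) y₀ * (y - y₀) + k₂ * (z - z₀) ∧
    D₃ y z = D₃ y₀ z₀ + k₃ * (y - y₀) + (k + deriv (fun t => D₂ t z₀) y₀) * (z - z₀) := by
  have hε : 0 < ε := dist_nonneg.trans_lt hy
  have hy₀ := Metric.mem_ball_self (x := y₀) hε
  have hz₀ := Metric.mem_ball_self (x := z₀) hε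
  have e2 : ∀ y ∈ Metric.ball y₀ ε, ∀ z ∈ Metric.ball z₀ ε, D₂ y z = D₂ y z₀ + k₂ * (z - z₀) :=
    fun y hy z hz => eq_add_mul_of_deriv_eq (hd₂z y hy) (h₂ y hy) hz
  have e3 : ∀ y ∈ Metric.ball y₀ ε, ∀ z ∈ Metric.ball z₀ ε, D₃ y z = D₃ y₀ z + k₃ * (y - y₀) :=
    fun y hy z hz => eq_add_mul_of_deriv_eq (g := fun t => D₃ t z) (fun y hy => hd₃y y hy z hz)
      (fun y hy => h₃ y hy z hz) hy
  -- ∂D₂/∂y does not depend on z and ∂D₃/∂z does not depend on y; as they differ by a constant, both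
  -- are constant.
  have f2 : ∀ y ∈ Metric.ball y₀ ε, ∀ z ∈ Metric.ball z₀ ε,
      deriv (fun t => D₂ t z) y = deriv (fun t => D₂ t z₀) y := fun y hy z hz => by
    have : (fun t => D₂ t z) =ᶠ[𝓝 y] fun t => D₂ t z₀ + k₂ * (z - z₀) := by
      filter_upwards [Metric.isOpen_ball.mem_nhds hy] with t ht using e2 t ht z hz
    rw [this.deriv_eq, deriv_add_const]
  have f3 : ∀ y ∈ Metric.ball y₀ ε, ∀ z ∈ Metric.ball z₀ ε,
      deriv (D₃ y) z = deriv (D₃ y₀) z := fun y hy z hz => by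
    have : D₃ y =ᶠ[𝓝 z] fun t => D₃ y₀ t + k₃ * (y - y₀) := by
      filter_upwards [Metric.isOpen_ball.mem_nhds hz] with t ht using e3 y hy t ht
    rw [this.deriv_eq, deriv_add_const]
  have c2 := eq_add_mul_of_deriv_eq (g := fun t => D₂ t z₀) (k := deriv (fun t => D₂ t z₀) y₀)
    (fun y hy => hd₂y y hy z₀ hz₀)
    (fun y hy => by linarith [h y hy z₀ hz₀, f3 y hy z₀ hz₀, h y₀ hy₀ z₀ hz₀]) hy
  have c3 := eq_add_mul_of_deriv_eq (g := D₃ y₀) (k := k + deriv (fun t => D₂ t z₀) y₀)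
    (fun z hz => hd₃z y₀ hy₀ z hz)
    (fun z hz => by linarith [h y₀ hy₀ z hz, f2 y₀ hy₀ z hz]) hz
  constructor
  · linarith [e2 y hy z hz]
  · linarith [e3 y hy z hz]

/-- A diffeomorphism of intervals together with fibrewise affine isomorphisms gives a
fibre-preserving diffeomorphism. -/
theorem exists_fibrewise_affine_diffeo (e : OpenPartialHomeomorph ℝ ℝ)
    (he : ContDiffOn ℝ ∞ e e.source) (hes : ContDiffOn ℝ ∞ e.symm e.target)
    {a b c d u v : ℝ → ℝ} (ha : ContDiffOn ℝ ∞ a e.source) (hb : ContDiffOn ℝ ∞ b e.source)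
    (hc : ContDiffOn ℝ ∞ c e.source) (hd : ContDiffOn ℝ ∞ d e.source)
    (hu : ContDiffOn ℝ ∞ u e.source) (hv : ContDiffOn ℝ ∞ v e.source)
    (hdet : ∀ x ∈ e.source, a x * d x - b x * c x ≠ 0) :
    ∃ φ : OpenPartialHomeomorph XYZ XYZ, φ.source = Prod.fst ⁻¹' e.source ∧
      (∀ p, φ p = (e p.1, a p.1 * (p.2.1 - u p.1) + b p.1 * (p.2.2 - v p.1),
        c p.1 * (p.2.1 - u p.1) + d p.1 * (p.2.2 - v p.1))) ∧
      ContDiffOn ℝ ∞ φ φ.source ∧ ContDiffOn ℝ ∞ φ.symm φ.target := by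
  let F : XYZ → XYZ := fun p => (e p.1, a p.1 * (p.2.1 - u p.1) + b p.1 * (p.2.2 - v p.1),
        c p.1 * (p.2.1 - u p.1) + d p.1 * (p.2.2 - v p.1))
  -- The fibrewise inverse, by Cramer's rule.
  let G₀ : XYZ → XYZ := fun r => (r.1,
    u r.1 + (d r.1 * r.2.1 - b r.1 * r.2.2) / (a r.1 * d r.1 - b r.1 * c r.1),
    v r.1 + (a r.1 * r.2.2 - c r.1 * r.2.1) / (a r.1 * d r.1 - b r.1 * c r.1))
  let G : XYZ → XYZ := fun r => G₀ (e.symm r.1, r.2)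
  have hmaps : MapsTo (Prod.fst : XYZ → ℝ) (Prod.fst ⁻¹' e.source) e.source := fun p hp => hp
  have hl : ∀ {g : ℝ → ℝ}, ContDiffOn ℝ ∞ g e.source →
      ContDiffOn ℝ ∞ (fun p : XYZ => g p.1) (Prod.fst ⁻¹' e.source) := fun hg =>
    hg.comp contDiffOn_fst hmaps
  have hF : ContDiffOn ℝ ∞ F (Prod.fst ⁻¹' e.source) := by
    have h1 : ContDiffOn ℝ ∞ (fun p : XYZ => p.2.1 - u p.1) (Prod.fst ⁻¹' e.source) :=
      contDiff_snd.fst.contDiffOn.sub (hl hu)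
    have h2 : ContDiffOn ℝ ∞ (fun p : XYZ => p.2.2 - v p.1) (Prod.fst ⁻¹' e.source) :=
      contDiff_snd.snd.contDiffOn.sub (hl hv)
    exact (hl he).prodMk ((((hl ha).mul h1).add ((hl hb).mul h2)).prodMk
      (((hl hc).mul h1).add ((hl hd).mul h2)))
  have hG₀ : ContDiffOn ℝ ∞ G₀ (Prod.fst ⁻¹' e.source) := by
    have h1 : ContDiffOn ℝ ∞ (fun p : XYZ => p.2.1) (Prod.fst ⁻¹' e.source) :=
      contDiff_snd.fst.contDiffOn
    have h2 : ContDiffOn ℝ ∞ (fun p : XYZ => p.2.2) (Prod.fst ⁻¹' e.source) :=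
      contDiff_snd.snd.contDiffOn
    have h3 := ((hl ha).mul (hl hd)).sub ((hl hb).mul (hl hc))
    exact contDiffOn_fst.prodMk
      (((hl hu).add ((((hl hd).mul h1).sub ((hl hb).mul h2)).div h3 fun p hp => hdet _ hp)).prodMk
      ((hl hv).add ((((hl ha).mul h2).sub ((hl hc).mul h1)).div h3 fun p hp => hdet _ hp)))
  have hG : ContDiffOn ℝ ∞ G (Prod.fst ⁻¹' e.target) :=
    hG₀.comp ((hes.comp contDiffOn_fst fun p hp => hp).prodMk contDiffOn_snd)
      fun p hp => e.map_target hp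
  refine ⟨{ toFun := F, invFun := G, source := Prod.fst ⁻¹' e.source,
            target := Prod.fst ⁻¹' e.target, map_source' := fun p hp => e.map_source hp,
            map_target' := fun p hp => e.map_target hp, left_inv' := fun p hp => ?_,
            right_inv' := fun p hp => ?_,
            open_source := e.open_source.preimage continuous_fst,
            open_target := e.open_target.preimage continuous_fst,
            continuousOn_toFun := hF.continuousOn, continuousOn_invFun := hG.continuousOn },
    rfl, fun p => rfl, hF, hG⟩
  · have h1 := hdet _ hp
    have h2 := e.left_inv hp
    ext <;> simp only [F, G, G₀, h2]
    · rw [add_comm, ← eq_sub_iff_add_eq, div_eq_iff h1]; ring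
    · rw [add_comm, ← eq_sub_iff_add_eq, div_eq_iff h1]; ring
  · have h1 := hdet _ (e.map_target hp)
    have h2 := e.right_inv hp
    ext <;> simp only [F, G, G₀, h2, add_sub_cancel_left]
    · rw [← mul_div_assoc, ← mul_div_assoc, ← add_div, div_eq_iff h1]; ring
    · rw [← mul_div_assoc, ← mul_div_assoc, ← add_div, div_eq_iff h1]; ring

/-- A fibrewise affine point transformation, built from a particular solution `(u, v)`, a
solution of `2 Q' = Q C` and a solution of `s'' + lam s = 0`, straightens the system. -/
theorem transforms_freeParticle_of_fibrewise_affine {φ : OpenPartialHomeomorph XYZ XYZ}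
    {C22 C23 C32 C33 : ℝ → ℝ} {D2 D3 : XYZ → ℝ} {N : Set ℝ}
    {X s s₁ lam q₁₁ q₁₂ q₂₁ q₂₂ u v : ℝ → ℝ}
    (h22 : ∀ x ∈ N, DifferentiableAt ℝ C22 x) (h23 : ∀ x ∈ N, DifferentiableAt ℝ C23 x)
    (h32 : ∀ x ∈ N, DifferentiableAt ℝ C32 x) (h33 : ∀ x ∈ N, DifferentiableAt ℝ C33 x)
    (hs : ∀ x ∈ N, HasDerivAt s (s₁ x) x) (hs₁ : ∀ x ∈ N, HasDerivAt s₁ (-(lam x * s x)) x)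
    (hs₀ : ∀ x ∈ N, s x ≠ 0) (hX : ∀ x ∈ N, HasDerivAt X (1 / s x ^ 2) x)
    (hq₁₁ : ∀ x ∈ N, HasDerivAt q₁₁ (1 / 2 * (q₁₁ x * C22 x + q₁₂ x * C32 x)) x)
    (hq₁₂ : ∀ x ∈ N, HasDerivAt q₁₂ (1 / 2 * (q₁₁ x * C23 x + q₁₂ x * C33 x)) x)
    (hq₂₁ : ∀ x ∈ N, HasDerivAt q₂₁ (1 / 2 * (q₂₁ x * C22 x + q₂₂ x * C32 x)) x)
    (hq₂₂ : ∀ x ∈ N, HasDerivAt q₂₂ (1 / 2 * (q₂₁ x * C23 x + q₂₂ x * C33 x)) x)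
    (hdet : ∀ x ∈ N, q₁₁ x * q₂₂ x - q₁₂ x * q₂₁ x ≠ 0)
    (huv : IsSolutionOn (linearInDerivatives C22 C23 C32 C33 D2 D3) N u v)
    (hsrc : ∀ p ∈ φ.source, p.1 ∈ N)
    (hφ : ∀ p, φ p = (X p.1,
      q₁₁ p.1 / s p.1 * (p.2.1 - u p.1) + q₁₂ p.1 / s p.1 * (p.2.2 - v p.1),
      q₂₁ p.1 / s p.1 * (p.2.1 - u p.1) + q₂₂ p.1 / s p.1 * (p.2.2 - v p.1)))
    (hD2 : ∀ p ∈ φ.source, D2 p = D2 (p.1, u p.1, v p.1)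
      + (1 / 2 * deriv C22 p.1 + 1 / 4 * (C22 p.1 * C22 p.1 + C23 p.1 * C32 p.1) + lam p.1)
        * (p.2.1 - u p.1)
      + (1 / 2 * deriv C23 p.1 + 1 / 4 * (C22 p.1 * C23 p.1 + C23 p.1 * C33 p.1))
        * (p.2.2 - v p.1))
    (hD3 : ∀ p ∈ φ.source, D3 p = D3 (p.1, u p.1, v p.1)
      + (1 / 2 * deriv C32 p.1 + 1 / 4 * (C32 p.1 * C22 p.1 + C33 p.1 * C32 p.1))
        * (p.2.1 - u p.1)
      + (1 / 2 * deriv C33 p.1 + 1 / 4 * (C32 p.1 * C23 p.1 + C33 p.1 * C33 p.1) + lam p.1)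
        * (p.2.2 - v p.1)) :
    Transforms φ (linearInDerivatives C22 C23 C32 C33 D2 D3) freeParticle := by
  intro J K y z Y Z hJ _ hK _ hy hz hY hZ hgraph himage
  have hsrcJ : ∀ x ∈ J, (x, y x, z x) ∈ φ.source := fun x hx => hgraph ⟨x, hx, rfl⟩
  have hJN : ∀ x ∈ J, x ∈ N := fun x hx => hsrc _ (hsrcJ x hx)
  have hpt : ∀ x ∈ J, X x ∈ K ∧
      Y (X x) = q₁₁ x / s x * (y x - u x) + q₁₂ x / s x * (z x - v x) ∧
      Z (X x) = q₂₁ x / s x * (y x - u x) + q₂₂ x / s x * (z x - v x) := by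
    intro x hx
    obtain ⟨ξ, hξ, h⟩ : φ (x, y x, z x) ∈ curveGraph K Y Z := himage ▸ ⟨_, ⟨x, hx, rfl⟩, rfl⟩
    rw [hφ] at h
    obtain ⟨h1, h2, h3⟩ := by simpa only [Prod.mk.injEq] using h
    subst h1
    exact ⟨hξ, h2, h3⟩
  have hsurj : ∀ ξ ∈ K, ∃ x ∈ J, ξ = X x := by
    intro ξ hξ
    obtain ⟨_, ⟨x, hx, rfl⟩, h⟩ : (ξ, Y ξ, Z ξ) ∈ φ '' curveGraph J y z := himage ▸ ⟨ξ, hξ, rfl⟩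
    rw [hφ] at h
    exact ⟨x, hx, (congrArg Prod.fst h).symm⟩
  obtain ⟨hu, hv, huvN⟩ := huv
  have hu' := hu.mono hJN
  have hv' := hv.mono hJN
  have hd : ∀ {g w : ℝ → ℝ}, ContDiffOn ℝ 2 g J → ContDiffOn ℝ 2 w J → ∀ x ∈ J,
      deriv (fun x => g x - w x) x = deriv g x - deriv w x ∧
      deriv (deriv fun x => g x - w x) x = deriv (deriv g) x - deriv (deriv w) x := by
    intro g w hg hw x hx
    have h1 : ∀ x ∈ J, deriv (fun x => g x - w x) x = deriv g x - deriv w x := fun x hx =>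
      ((hg.hasDerivAt_deriv_deriv hJ hx).1.sub (hw.hasDerivAt_deriv_deriv hJ hx).1).deriv
    refine ⟨h1 x hx, ?_⟩
    have h2 : deriv (fun x => g x - w x) =ᶠ[nhds x] fun x => deriv g x - deriv w x := by
      filter_upwards [hJ.mem_nhds hx] with t ht using h1 t ht
    rw [h2.deriv_eq]
    exact ((hg.hasDerivAt_deriv_deriv hJ hx).2.sub (hw.hasDerivAt_deriv_deriv hJ hx).2).deriv
  -- `E₂` and `E₃` are the defects of the original equations. The second derivatives of Y and Z turn
  -- out to be s³Q applied to them, and s³Q is invertible, so both directions follow.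
  let E₂ : ℝ → ℝ := fun x => deriv (deriv y) x
    + (linearInDerivatives C22 C23 C32 C33 D2 D3 (x, y x, z x) (deriv y x, deriv z x)).1
  let E₃ : ℝ → ℝ := fun x => deriv (deriv z) x
    + (linearInDerivatives C22 C23 C32 C33 D2 D3 (x, y x, z x) (deriv y x, deriv z x)).2
  have main : ∀ {W q₁ q₂ : ℝ → ℝ}, ContDiffOn ℝ 2 W K →
      (∀ x ∈ N, HasDerivAt q₁ (1 / 2 * (q₁ x * C22 x + q₂ x * C32 x)) x) →
      (∀ x ∈ N, HasDerivAt q₂ (1 / 2 * (q₁ x * C23 x + q₂ x * C33 x)) x) →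
      (∀ x ∈ J, W (X x) = q₁ x / s x * (y x - u x) + q₂ x / s x * (z x - v x)) →
      ∀ x ∈ J, deriv (deriv W) (X x) = s x ^ 3 * (q₁ x * E₂ x + q₂ x * E₃ x) := by
    intro W q₁ q₂ hW hq₁ hq₂ hWX x hx
    rw [deriv_deriv_eq_of_reparam hJ (fun x hx => hs x (hJN x hx)) (fun x hx => hs₁ x (hJN x hx))
      (fun x hx => hs₀ x (hJN x hx)) (fun x hx => hX x (hJN x hx)) (fun x hx => hq₁ x (hJN x hx))
      (fun x hx => hq₂ x (hJN x hx)) (fun x hx => h22 x (hJN x hx)) (fun x hx => h23 x (hJN x hx))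
      (fun x hx => h32 x (hJN x hx)) (fun x hx => h33 x (hJN x hx)) (hy.sub hu') (hz.sub hv')
      (fun x hx => (hW.hasDerivAt_deriv_deriv hK (hpt x hx).1).1)
      (fun x hx => (hW.hasDerivAt_deriv_deriv hK (hpt x hx).1).2)
      (fun x hx => by rw [hWX x hx]; ring) hx]
    obtain ⟨a1, a2⟩ := hd hy hu' x hx
    obtain ⟨b1, b2⟩ := hd hz hv' x hx
    obtain ⟨c1, c2⟩ := huvN x (hJN x hx)
    simp only [linearInDerivatives] at c1 c2
    simp only [a1, a2, b1, b2, E₂, E₃, linearInDerivatives, hD2 _ (hsrcJ x hx),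
      hD3 _ (hsrcJ x hx)]
    -- The equations of the particular solution absorb the terms of D that are independent of h.
    linear_combination (-s x ^ 3 * q₁ x) * c1 - s x ^ 3 * q₂ x * c2
  have hYd := main hY hq₁₁ hq₁₂ fun x hx => (hpt x hx).2.1
  have hZd := main hZ hq₂₁ hq₂₂ fun x hx => (hpt x hx).2.2
  constructor
  · rintro ⟨-, -, hsol⟩
    refine ⟨hY, hZ, fun ξ hξ => ?_⟩
    obtain ⟨x, hx, rfl⟩ := hsurj ξ hξ
    obtain ⟨e2, e3⟩ := hsol x hx
    have e2' : E₂ x = 0 := e2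
    have e3' : E₃ x = 0 := e3
    simp [freeParticle, hYd x hx, hZd x hx, e2', e3']
  · rintro ⟨-, -, hsol⟩
    refine ⟨hy, hz, fun x hx => ?_⟩
    obtain ⟨e2, e3⟩ := hsol _ (hpt x hx).1
    simp only [freeParticle, add_zero, hYd x hx, hZd x hx, mul_eq_zero, pow_eq_zero_iff, ne_eq,
      OfNat.ofNat_ne_zero, not_false_eq_true, hs₀ x (hJN x hx), false_or] at e2 e3
    have hdx := hdet x (hJN x hx)
    constructor
    · refine (mul_eq_zero.1 ?_).resolve_left hdx
      change _ * E₂ x = 0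
      linear_combination q₂₂ x * e2 - q₁₂ x * e3
    · refine (mul_eq_zero.1 ?_).resolve_left hdx
      change _ * E₃ x = 0
      linear_combination q₁₁ x * e3 - q₂₁ x * e2

/-! ### Sufficiency: local construction of the straightening map -/

theorem partialY_eq_fderiv {D : XYZ → ℝ} {p : XYZ} (hD : DifferentiableAt ℝ D p) :
    partialY D p = fderiv ℝ D p unitY :=
  ((show HasFDerivAt D (fderiv ℝ D p) (p.1, p.2.1, p.2.2) from hD.hasFDerivAt).comp_hasDerivAt
    p.2.1 ((hasDerivAt_const _ _).prodMk ((hasDerivAt_id _).prodMk (hasDerivAt_const _ _)))).deriv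

theorem partialZ_eq_fderiv {D : XYZ → ℝ} {p : XYZ} (hD : DifferentiableAt ℝ D p) :
    partialZ D p = fderiv ℝ D p unitZ :=
  ((show HasFDerivAt D (fderiv ℝ D p) (p.1, p.2.1, p.2.2) from hD.hasFDerivAt).comp_hasDerivAt
    p.2.2 ((hasDerivAt_const _ _).prodMk ((hasDerivAt_const _ _).prodMk (hasDerivAt_id _)))).deriv

-- All ingredients u, v, Q, s and X solve ODEs with smooth data, so they exist near the given x₀;
-- the map is cut down to a cube on which D is affine in (y, z).
open Topology Filter in
theorem pointTransformable_of_partial_eq {Ω : Set XYZ} (hΩ : IsOpen Ω)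
    {C22 C23 C32 C33 : ℝ → ℝ} {D2 D3 : XYZ → ℝ}
    (h22 : ContDiffOn ℝ ∞ C22 (Prod.fst '' Ω)) (h23 : ContDiffOn ℝ ∞ C23 (Prod.fst '' Ω))
    (h32 : ContDiffOn ℝ ∞ C32 (Prod.fst '' Ω)) (h33 : ContDiffOn ℝ ∞ C33 (Prod.fst '' Ω))
    (hD2 : ContDiffOn ℝ ∞ D2 Ω) (hD3 : ContDiffOn ℝ ∞ D3 Ω)
    (h : ∀ p ∈ Ω,
      1 / 2 * deriv C32 p.1 + 1 / 4 * C33 p.1 * C32 p.1 + 1 / 4 * C22 p.1 * C32 p.1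
          = partialY D3 p ∧
      1 / 2 * deriv C23 p.1 + 1 / 4 * C23 p.1 * C33 p.1 + 1 / 4 * C23 p.1 * C22 p.1
          = partialZ D2 p ∧
      1 / 2 * deriv C33 p.1 - 1 / 2 * deriv C22 p.1
          + 1 / 4 * C33 p.1 * C33 p.1 - 1 / 4 * C22 p.1 * C22 p.1
          = partialZ D3 p - partialY D2 p) :
    PointTransformable Ω (linearInDerivatives C22 C23 C32 C33 D2 D3) freeParticle := by
  rintro ⟨x₀, y₀, z₀⟩ hp₀
  have hinf : (∞ : WithTop ℕ∞) ≠ 0 := by simp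
  have hle : (2 : WithTop ℕ∞) ≤ ∞ := by norm_cast
  obtain ⟨ε, hε, hball⟩ := Metric.isOpen_iff.1 hΩ _ hp₀
  -- Balls of the sup metric are cubes, so integration along coordinate segments stays inside Ω.
  have hmem : ∀ x ∈ Metric.ball x₀ ε, ∀ y ∈ Metric.ball y₀ ε, ∀ z ∈ Metric.ball z₀ ε,
      (x, y, z) ∈ Ω := fun x hx y hy z hz => hball <| by
    rw [← ball_prod_same, ← ball_prod_same]; exact ⟨hx, hy, hz⟩
  have hx₀ : x₀ ∈ Metric.ball x₀ ε := Metric.mem_ball_self hε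
  have hy₀ : y₀ ∈ Metric.ball y₀ ε := Metric.mem_ball_self hε
  have hz₀ : z₀ ∈ Metric.ball z₀ ε := Metric.mem_ball_self hε
  have hI : IsOpen (Prod.fst '' Ω) := isOpenMap_fst _ hΩ
  have hsub : Metric.ball x₀ ε ⊆ Prod.fst '' Ω := fun x hx => ⟨_, hmem x hx _ hy₀ _ hz₀, rfl⟩
  have hx₀I : x₀ ∈ Prod.fst '' Ω := hsub hx₀
  have hdiff : ∀ {g : ℝ → ℝ}, ContDiffOn ℝ ∞ g (Prod.fst '' Ω) → ∀ x ∈ Metric.ball x₀ ε,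
      DifferentiableAt ℝ g x := fun hg x hx =>
    (hg.contDiffAt (hI.mem_nhds (hsub hx))).differentiableAt hinf
  have hdiffD : ∀ {D : XYZ → ℝ}, ContDiffOn ℝ ∞ D Ω → ∀ p ∈ Ω, DifferentiableAt ℝ D p :=
    fun hD p hp => (hD.contDiffAt (hΩ.mem_nhds hp)).differentiableAt hinf
  -- `D2` and `D3` are affine in the dependent variables
  let κ : ℝ → ℝ := fun x => partialY D2 (x, y₀, z₀)
  have haff : ∀ x ∈ Metric.ball x₀ ε, ∀ y ∈ Metric.ball y₀ ε, ∀ z ∈ Metric.ball z₀ ε,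
      D2 (x, y, z) = D2 (x, y₀, z₀) + κ x * (y - y₀)
        + (1 / 2 * deriv C23 x + 1 / 4 * C23 x * C33 x + 1 / 4 * C23 x * C22 x) * (z - z₀) ∧
      D3 (x, y, z) = D3 (x, y₀, z₀)
        + (1 / 2 * deriv C32 x + 1 / 4 * C33 x * C32 x + 1 / 4 * C22 x * C32 x) * (y - y₀)
        + (1 / 2 * deriv C33 x - 1 / 2 * deriv C22 x
          + 1 / 4 * C33 x * C33 x - 1 / 4 * C22 x * C22 x + κ x) * (z - z₀) := by
    intro x hx y hy z hz
    have hfy : ∀ {D : XYZ → ℝ}, ContDiffOn ℝ ∞ D Ω → ∀ y ∈ Metric.ball y₀ ε,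
        ∀ z ∈ Metric.ball z₀ ε, DifferentiableAt ℝ (fun t => D (x, t, z)) y :=
      fun hD y hy z hz => (hdiffD hD _ (hmem x hx y hy z hz)).comp y
        ((differentiableAt_const x).prodMk (differentiableAt_id.prodMk (differentiableAt_const z)))
    have hfz : ∀ {D : XYZ → ℝ}, ContDiffOn ℝ ∞ D Ω → ∀ y ∈ Metric.ball y₀ ε,
        ∀ z ∈ Metric.ball z₀ ε, DifferentiableAt ℝ (fun t => D (x, y, t)) z :=
      fun hD y hy z hz => (hdiffD hD _ (hmem x hx y hy z hz)).comp z
        ((differentiableAt_const x).prodMk ((differentiableAt_const y).prodMk differentiableAt_id))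
    exact eq_affine_of_deriv_eq (D₂ := fun y z => D2 (x, y, z)) (D₃ := fun y z => D3 (x, y, z))
      (k₂ := 1 / 2 * deriv C23 x + 1 / 4 * C23 x * C33 x + 1 / 4 * C23 x * C22 x)
      (k₃ := 1 / 2 * deriv C32 x + 1 / 4 * C33 x * C32 x + 1 / 4 * C22 x * C32 x)
      (k := 1 / 2 * deriv C33 x - 1 / 2 * deriv C22 x
        + 1 / 4 * C33 x * C33 x - 1 / 4 * C22 x * C22 x)
      (hfy hD2) (hfz hD2) (hfy hD3) (hfz hD3)
      (fun y hy z hz => (h _ (hmem x hx y hy z hz)).1.symm)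
      (fun y hy z hz => (h _ (hmem x hx y hy z hz)).2.1.symm)
      (fun y hy z hz => (h _ (hmem x hx y hy z hz)).2.2.symm) hy hz
  -- λ is read off from the (y, y) entry of the Jacobian of D; the third condition makes the (z, z)
  -- entry give the same function.
  let lam : ℝ → ℝ := fun x =>
    κ x - (1 / 2 * deriv C22 x + 1 / 4 * (C22 x * C22 x + C23 x * C32 x))
  have hlam : ContDiffOn ℝ ∞ lam (Metric.ball x₀ ε) := by
    have h1 : ContDiffOn ℝ ∞ κ (Metric.ball x₀ ε) := by
      have h2 : ContDiffOn ℝ ∞ (fun p => fderiv ℝ D2 p unitY) Ω :=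
        ((contDiffOn_infty_iff_fderiv_of_isOpen hΩ).1 hD2).2.clm_apply contDiffOn_const
      refine (h2.comp (contDiffOn_id.prodMk (contDiffOn_const (c := (y₀, z₀))))
        fun x hx => hmem x hx _ hy₀ _ hz₀).congr fun x hx => ?_
      exact partialY_eq_fderiv (hdiffD hD2 _ (hmem x hx _ hy₀ _ hz₀))
    have h2 := ((contDiffOn_infty_iff_deriv_of_isOpen hI).1 h22).2.mono hsub
    exact h1.sub ((contDiffOn_const.mul h2).add (contDiffOn_const.mul
      (((h22.mono hsub).mul (h22.mono hsub)).add ((h23.mono hsub).mul (h32.mono hsub)))))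
  -- solutions of the auxiliary equations
  have hcomp : ∀ {E : Type} [NormedAddCommGroup E] [NormedSpace ℝ E] {g : ℝ → ℝ} {U : Set ℝ},
      ContDiffOn ℝ ∞ g U → ContDiffOn ℝ ∞ (fun r : ℝ × E => g r.1) (Prod.fst ⁻¹' U) :=
    fun hg => hg.comp contDiffOn_fst fun r hr => hr
  have hrow : ∀ a : ℝ × ℝ, ∃ q : ℝ → ℝ × ℝ, q x₀ = a ∧ ∀ᶠ x in 𝓝 x₀,
      HasDerivAt (fun x => (q x).1) (1 / 2 * ((q x).1 * C22 x + (q x).2 * C32 x)) x ∧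
      HasDerivAt (fun x => (q x).2) (1 / 2 * ((q x).1 * C23 x + (q x).2 * C33 x)) x ∧
      ContDiffAt ℝ ∞ q x := by
    intro a
    obtain ⟨q, hq₀, hq⟩ := exists_local_solution (hI.preimage continuous_fst)
      (F := fun r : ℝ × ℝ × ℝ => ((1 / 2 * (r.2.1 * C22 r.1 + r.2.2 * C32 r.1),
        1 / 2 * (r.2.1 * C23 r.1 + r.2.2 * C33 r.1)) : ℝ × ℝ))
      (by
        have h1 := hcomp (E := ℝ × ℝ) h22
        have h2 := hcomp (E := ℝ × ℝ) h23
        have h3 := hcomp (E := ℝ × ℝ) h32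
        have h4 := hcomp (E := ℝ × ℝ) h33
        have h5 : ContDiffOn ℝ ∞ (fun r : ℝ × ℝ × ℝ => r.2.1) (Prod.fst ⁻¹' (Prod.fst '' Ω)) :=
          contDiff_snd.fst.contDiffOn
        have h6 : ContDiffOn ℝ ∞ (fun r : ℝ × ℝ × ℝ => r.2.2) (Prod.fst ⁻¹' (Prod.fst '' Ω)) :=
          contDiff_snd.snd.contDiffOn
        exact (contDiffOn_const.mul ((h5.mul h1).add (h6.mul h3))).prodMk
          (contDiffOn_const.mul ((h5.mul h2).add (h6.mul h4)))) (t₀ := x₀) (e₀ := a) hx₀I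
    refine ⟨q, hq₀, hq.mono fun x hx => ⟨?_, ?_, hx.2.2⟩⟩
    · exact hx.2.1.hasFDerivAt.fst.hasDerivAt.congr_deriv (by simp)
    · exact hx.2.1.hasFDerivAt.snd.hasDerivAt.congr_deriv (by simp)
  -- The rows of Q start from the identity matrix, so Q is invertible near x₀; likewise s(x₀) = 1
  -- keeps s nonzero there.
  obtain ⟨q₁, hq₁₀, hq₁⟩ := hrow (1, 0)
  obtain ⟨q₂, hq₂₀, hq₂⟩ := hrow (0, 1)
  obtain ⟨σ, hσ₀, hσ⟩ := exists_local_solution (Metric.isOpen_ball.preimage continuous_fst)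
      (F := fun r : ℝ × ℝ × ℝ => ((r.2.2, -(lam r.1 * r.2.1)) : ℝ × ℝ))
      (by
        have h1 := hcomp (E := ℝ × ℝ) hlam
        exact contDiff_snd.snd.contDiffOn.prodMk
          (h1.mul contDiff_snd.fst.contDiffOn).neg) (t₀ := x₀) (e₀ := (1, 0)) hx₀
  -- The particular solution as a first-order system for ((u, v), (u', v')), started at (y₀, z₀) so
  -- that its graph stays in the cube near x₀.
  obtain ⟨w, hw₀, hw⟩ := exists_local_solution
      (W := (fun r : ℝ × (ℝ × ℝ) × (ℝ × ℝ) => ((r.1, r.2.1) : XYZ)) ⁻¹' Ω)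
      (hΩ.preimage (by fun_prop))
      (F := fun r : ℝ × (ℝ × ℝ) × (ℝ × ℝ) => ((r.2.2,
        (-(C22 r.1 * r.2.2.1 + C23 r.1 * r.2.2.2 + D2 (r.1, r.2.1)),
        -(C32 r.1 * r.2.2.1 + C33 r.1 * r.2.2.2 + D3 (r.1, r.2.1)))) : (ℝ × ℝ) × (ℝ × ℝ)))
      (by
        have hsub' : (fun r : ℝ × (ℝ × ℝ) × (ℝ × ℝ) => ((r.1, r.2.1) : XYZ)) ⁻¹' Ω
            ⊆ Prod.fst ⁻¹' (Prod.fst '' Ω) := fun r hr => ⟨_, hr, rfl⟩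
        have hDc : ∀ {D : XYZ → ℝ}, ContDiffOn ℝ ∞ D Ω →
            ContDiffOn ℝ ∞ (fun r : ℝ × (ℝ × ℝ) × (ℝ × ℝ) => D (r.1, r.2.1))
              ((fun r : ℝ × (ℝ × ℝ) × (ℝ × ℝ) => ((r.1, r.2.1) : XYZ)) ⁻¹' Ω) :=
          fun hD => hD.comp (by fun_prop) fun r hr => hr
        have h1 := (hcomp (E := (ℝ × ℝ) × (ℝ × ℝ)) h22).mono hsub'
        have h2 := (hcomp (E := (ℝ × ℝ) × (ℝ × ℝ)) h23).mono hsub'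
        have h3 := (hcomp (E := (ℝ × ℝ) × (ℝ × ℝ)) h32).mono hsub'
        have h4 := (hcomp (E := (ℝ × ℝ) × (ℝ × ℝ)) h33).mono hsub'
        have h5 := hDc hD2
        have h6 := hDc hD3
        have h7 : ContDiffOn ℝ ∞ (fun r : ℝ × (ℝ × ℝ) × (ℝ × ℝ) => r.2.2)
            ((fun r : ℝ × (ℝ × ℝ) × (ℝ × ℝ) => ((r.1, r.2.1) : XYZ)) ⁻¹' Ω) :=
          contDiff_snd.snd.contDiffOn
        exact h7.prodMk
          ((((h1.mul h7.fst).add (h2.mul h7.snd)).add h5).neg.prodMk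
            (((h3.mul h7.fst).add (h4.mul h7.snd)).add h6).neg)) (t₀ := x₀) (e₀ := ((y₀, z₀), (0, 0))) hp₀
  have cq₁ : ContinuousAt q₁ x₀ := hq₁.self_of_nhds.2.2.continuousAt
  have cq₂ : ContinuousAt q₂ x₀ := hq₂.self_of_nhds.2.2.continuousAt
  have cσ : ContinuousAt σ x₀ := hσ.self_of_nhds.2.2.continuousAt
  have cw : ContinuousAt w x₀ := hw.self_of_nhds.2.2.continuousAt
  have hdet : ∀ᶠ x in 𝓝 x₀, (q₁ x).1 * (q₂ x).2 - (q₁ x).2 * (q₂ x).1 ≠ 0 :=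
    ContinuousAt.eventually_ne (by fun_prop) (by simp [hq₁₀, hq₂₀])
  have hs₀ : ∀ᶠ x in 𝓝 x₀, (σ x).1 ≠ 0 :=
    ContinuousAt.eventually_ne (by fun_prop) (by simp [hσ₀])
  have hwball : ∀ᶠ x in 𝓝 x₀, (w x).1 ∈ Metric.ball (y₀, z₀) ε :=
    cw.fst.eventually_mem (Metric.isOpen_ball.mem_nhds (by simp [hw₀, hε]))
  obtain ⟨N, hN, hNo, hxN⟩ := eventually_nhds_iff.1 (hq₁.and <| hq₂.and <| hσ.and <| hw.and <|
    hdet.and <| hs₀.and <| hwball.and <| Metric.isOpen_ball.eventually_mem hx₀)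
  have hσN : ContDiffOn ℝ ∞ (fun x => (σ x).1) N := fun x hx =>
    (hN x hx).2.2.1.2.2.fst.contDiffWithinAt
  obtain ⟨X, -, hX⟩ := exists_local_solution (hNo.preimage continuous_fst)
      (F := fun r : ℝ × ℝ => 1 / (σ r.1).1 ^ 2)
      (contDiffOn_const.div ((hcomp (E := ℝ) hσN).pow 2)
        fun r hr => pow_ne_zero 2 (hN _ hr).2.2.2.2.2.1) (t₀ := x₀) (e₀ := 0) hxN
  obtain ⟨M, hM, hMo, hxM⟩ := eventually_nhds_iff.1 hX
  obtain ⟨e, heX, hxe, heM, -, -, -, hes⟩ := exists_interval_diffeo hMo hxM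
    (fun x hx => (hM x hx).2.2.contDiffWithinAt)
    (by rw [(hM _ hxM).2.1.deriv]; exact one_div_ne_zero (pow_ne_zero 2 (hN _ hxN).2.2.2.2.2.1))
  have heN : ∀ x ∈ e.source, x ∈ N := fun x hx => (hM x (heM hx)).1
  have hdiv : ∀ {g : ℝ → ℝ}, (∀ x ∈ N, ContDiffAt ℝ ∞ g x) →
      ContDiffOn ℝ ∞ (fun x => g x / (σ x).1) e.source := fun hg x hx =>
    ((hg x (heN x hx)).div (hN x (heN x hx)).2.2.1.2.2.fst
      (hN x (heN x hx)).2.2.2.2.2.1).contDiffWithinAt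
  have hwc : ∀ x ∈ N, ContDiffAt ℝ ∞ w x := fun x hx => (hN x hx).2.2.2.1.2.2
  obtain ⟨φ₀, hsrc, hφ₀, hs, hss⟩ := exists_fibrewise_affine_diffeo e
    (fun x hx => by rw [heX]; exact (hM x (heM hx)).2.2.contDiffWithinAt) hes
    (hdiv fun x hx => (hN x hx).1.2.2.fst) (hdiv fun x hx => (hN x hx).1.2.2.snd)
    (hdiv fun x hx => (hN x hx).2.1.2.2.fst) (hdiv fun x hx => (hN x hx).2.1.2.2.snd)
    (u := fun x => (w x).1.1) (v := fun x => (w x).1.2)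
    (fun x hx => (hwc x (heN x hx)).fst.fst.contDiffWithinAt)
    (fun x hx => (hwc x (heN x hx)).fst.snd.contDiffWithinAt)
    (fun x hx => by
      have h1 := (hN x (heN x hx)).2.2.2.2.1
      have h2 := (hN x (heN x hx)).2.2.2.2.2.1
      rw [div_mul_div_comm, div_mul_div_comm, ← sub_div]
      exact div_ne_zero h1 (mul_ne_zero h2 h2))
  let φ := φ₀.restrOpen (Metric.ball (x₀, y₀, z₀) ε) Metric.isOpen_ball
  have hφs : φ.source = Prod.fst ⁻¹' e.source ∩ Metric.ball (x₀, y₀, z₀) ε := by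
    rw [OpenPartialHomeomorph.restrOpen_source, hsrc]
  have hφsub : φ.source ⊆ φ₀.source := by rw [hφs, hsrc]; exact inter_subset_left
  have hφtsub : φ.target ⊆ φ₀.target := fun r hr => by
    have h1 := φ₀.map_source (hφsub (φ.map_target hr))
    have h2 : φ₀ (φ.symm r) = r := φ.right_inv hr
    rwa [h2] at h1
  -- the particular solution
  have hwd : ∀ x ∈ N, HasDerivAt (fun x => (w x).1.1) (w x).2.1 x ∧
      HasDerivAt (fun x => (w x).1.2) (w x).2.2 x ∧
      HasDerivAt (fun x => (w x).2.1)
        (-(C22 x * (w x).2.1 + C23 x * (w x).2.2 + D2 (x, (w x).1))) x ∧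
      HasDerivAt (fun x => (w x).2.2)
        (-(C32 x * (w x).2.1 + C33 x * (w x).2.2 + D3 (x, (w x).1))) x := by
    intro x hx
    have h1 := (hN x hx).2.2.2.1.2.1.hasFDerivAt
    refine ⟨?_, ?_, ?_, ?_⟩
    · exact h1.fst.fst.hasDerivAt.congr_deriv (by simp)
    · exact h1.fst.snd.hasDerivAt.congr_deriv (by simp)
    · exact h1.snd.fst.hasDerivAt.congr_deriv (by simp)
    · exact h1.snd.snd.hasDerivAt.congr_deriv (by simp)
  have hpart : IsSolutionOn (linearInDerivatives C22 C23 C32 C33 D2 D3) e.source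
      (fun x => (w x).1.1) (fun x => (w x).1.2) := by
    refine ⟨fun x hx => ((hwc x (heN x hx)).fst.fst.of_le hle).contDiffWithinAt,
      fun x hx => ((hwc x (heN x hx)).fst.snd.of_le hle).contDiffWithinAt, fun x hx => ?_⟩
    have hxN := heN x hx
    have h1 : deriv (fun x => (w x).1.1) =ᶠ[𝓝 x] fun x => (w x).2.1 := by
      filter_upwards [hNo.mem_nhds hxN] with t ht using (hwd t ht).1.deriv
    have h2 : deriv (fun x => (w x).1.2) =ᶠ[𝓝 x] fun x => (w x).2.2 := by
      filter_upwards [hNo.mem_nhds hxN] with t ht using (hwd t ht).2.1.deriv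
    rw [h1.deriv_eq, h2.deriv_eq, (hwd x hxN).2.2.1.deriv, (hwd x hxN).2.2.2.deriv,
      h1.self_of_nhds, h2.self_of_nhds]
    constructor <;> simp only [linearInDerivatives] <;> ring
  refine ⟨φ, ?_, ?_, hs.mono hφsub, hss.mono hφtsub, ?_⟩
  · rw [hφs]; exact ⟨hxe, Metric.mem_ball_self hε⟩
  · rw [hφs]; exact inter_subset_right.trans hball
  have hsrc' : ∀ p ∈ φ.source, p.1 ∈ e.source ∧ p.2.1 ∈ Metric.ball y₀ ε ∧
      p.2.2 ∈ Metric.ball z₀ ε ∧ (w p.1).1.1 ∈ Metric.ball y₀ ε ∧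
      (w p.1).1.2 ∈ Metric.ball z₀ ε ∧ p.1 ∈ Metric.ball x₀ ε := by
    intro p hp
    rw [hφs, ← ball_prod_same, ← ball_prod_same] at hp
    obtain ⟨h1, h2, h3, h4⟩ := hp
    have h5 := (hN _ (heN _ h1)).2.2.2.2.2.2.1
    rw [← ball_prod_same] at h5
    exact ⟨h1, h3, h4, h5.1, h5.2, h2⟩
  have heb : ∀ x ∈ e.source, x ∈ Metric.ball x₀ ε := fun x hx =>
    (hN _ (heN _ hx)).2.2.2.2.2.2.2
  refine transforms_freeParticle_of_fibrewise_affine (X := X)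
    (s := fun x => (σ x).1) (s₁ := fun x => (σ x).2) (lam := lam)
    (q₁₁ := fun x => (q₁ x).1) (q₁₂ := fun x => (q₁ x).2)
    (q₂₁ := fun x => (q₂ x).1) (q₂₂ := fun x => (q₂ x).2)
    (fun x hx => hdiff h22 x (heb x hx)) (fun x hx => hdiff h23 x (heb x hx))
    (fun x hx => hdiff h32 x (heb x hx)) (fun x hx => hdiff h33 x (heb x hx))
    (fun x hx => ((hN x (heN x hx)).2.2.1.2.1.hasFDerivAt.fst.hasDerivAt).congr_deriv (by simp))
    (fun x hx => ((hN x (heN x hx)).2.2.1.2.1.hasFDerivAt.snd.hasDerivAt).congr_deriv (by simp))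
    (fun x hx => (hN x (heN x hx)).2.2.2.2.2.1) (fun x hx => (hM x (heM hx)).2.1)
    (fun x hx => (hN x (heN x hx)).1.1) (fun x hx => (hN x (heN x hx)).1.2.1)
    (fun x hx => (hN x (heN x hx)).2.1.1) (fun x hx => (hN x (heN x hx)).2.1.2.1)
    (fun x hx => (hN x (heN x hx)).2.2.2.2.1) hpart (fun p hp => (hsrc' p hp).1)
    (fun p => heX ▸ hφ₀ p) (fun p hp => ?_) (fun p hp => ?_)
  · obtain ⟨-, h1, h2, h3, h4, h5⟩ := hsrc' p hp
    have e1 := (haff _ h5 _ h1 _ h2).1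
    have e2 := (haff _ h5 _ h3 _ h4).1
    simp only [Prod.mk.eta] at e1
    simp only [lam]
    -- The affine formula centred at (y₀, z₀) is recentred at (u, v) by subtracting its two
    -- instances.
    linear_combination e1 - e2
  · obtain ⟨-, h1, h2, h3, h4, h5⟩ := hsrc' p hp
    have e1 := (haff _ h5 _ h1 _ h2).2
    have e2 := (haff _ h5 _ h3 _ h4).2
    simp only [Prod.mk.eta] at e1
    simp only [lam]
    linear_combination e1 - e2

/-! ### The equivalence and the anisotropic oscillator -/

theorem linearInDerivatives_pointTransformable_iff {Ω : Set XYZ} (hΩ : IsOpen Ω)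
    {C22 C23 C32 C33 : ℝ → ℝ} {D2 D3 : XYZ → ℝ}
    (h22 : ContDiffOn ℝ ∞ C22 (Prod.fst '' Ω)) (h23 : ContDiffOn ℝ ∞ C23 (Prod.fst '' Ω))
    (h32 : ContDiffOn ℝ ∞ C32 (Prod.fst '' Ω)) (h33 : ContDiffOn ℝ ∞ C33 (Prod.fst '' Ω))
    (hD2 : ContDiffOn ℝ ∞ D2 Ω) (hD3 : ContDiffOn ℝ ∞ D3 Ω) :
    PointTransformable Ω (linearInDerivatives C22 C23 C32 C33 D2 D3) freeParticle ↔
    ∀ p ∈ Ω,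
      1 / 2 * deriv C32 p.1 + 1 / 4 * C33 p.1 * C32 p.1 + 1 / 4 * C22 p.1 * C32 p.1
          = partialY D3 p ∧
      1 / 2 * deriv C23 p.1 + 1 / 4 * C23 p.1 * C33 p.1 + 1 / 4 * C23 p.1 * C22 p.1
          = partialZ D2 p ∧
      1 / 2 * deriv C33 p.1 - 1 / 2 * deriv C22 p.1
          + 1 / 4 * C33 p.1 * C33 p.1 - 1 / 4 * C22 p.1 * C22 p.1
          = partialZ D3 p - partialY D2 p := by
  refine ⟨fun hT p hp => ?_, pointTransformable_of_partial_eq hΩ h22 h23 h32 h33 hD2 hD3⟩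
  have hinf : (∞ : WithTop ℕ∞) ≠ 0 := by simp
  obtain ⟨φ, hpφ, -, hs, hss, hφ⟩ := hT p hp
  have hd : ∀ {g : ℝ → ℝ}, ContDiffOn ℝ ∞ g (Prod.fst '' Ω) → DifferentiableAt ℝ g p.1 :=
    fun hg => (hg.contDiffAt ((isOpenMap_fst _ hΩ).mem_nhds ⟨p, hp, rfl⟩)).differentiableAt hinf
  have hd2 := (hD2.contDiffAt (hΩ.mem_nhds hp)).differentiableAt hinf
  have hd3 := (hD3.contDiffAt (hΩ.mem_nhds hp)).differentiableAt hinf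
  rw [partialY_eq_fderiv hd2, partialY_eq_fderiv hd3, partialZ_eq_fderiv hd2,
    partialZ_eq_fderiv hd3]
  exact hφ.partial_eq hs hss hpφ (hd h22) (hd h23) (hd h32) (hd h33) hd2 hd3

theorem corollary2 (Ω : Set XYZ) (hΩ : IsOpen Ω) :
    (∀ (C22 C23 C32 C33 : ℝ → ℝ) (D2 D3 : XYZ → ℝ),
      ContDiffOn ℝ ∞ C22 (Prod.fst '' Ω) → ContDiffOn ℝ ∞ C23 (Prod.fst '' Ω) →
      ContDiffOn ℝ ∞ C32 (Prod.fst '' Ω) → ContDiffOn ℝ ∞ C33 (Prod.fst '' Ω) →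
      ContDiffOn ℝ ∞ D2 Ω → ContDiffOn ℝ ∞ D3 Ω →
      (PointTransformable Ω (linearInDerivatives C22 C23 C32 C33 D2 D3) freeParticle ↔
        ∀ p ∈ Ω,
          1 / 2 * deriv C32 p.1 + 1 / 4 * C33 p.1 * C32 p.1 + 1 / 4 * C22 p.1 * C32 p.1
              = partialY D3 p ∧
          1 / 2 * deriv C23 p.1 + 1 / 4 * C23 p.1 * C33 p.1 + 1 / 4 * C23 p.1 * C22 p.1
              = partialZ D2 p ∧
          1 / 2 * deriv C33 p.1 - 1 / 2 * deriv C22 p.1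
              + 1 / 4 * C33 p.1 * C33 p.1 - 1 / 4 * C22 p.1 * C22 p.1
              = partialZ D3 p - partialY D2 p)) ∧
    (∀ ω₁ ω₂ : ℝ → ℝ,
      ContDiffOn ℝ ∞ ω₁ (Prod.fst '' Ω) → ContDiffOn ℝ ∞ ω₂ (Prod.fst '' Ω) →
      (PointTransformable Ω (anisotropicOscillator ω₁ ω₂) freeParticle ↔
        ∀ x ∈ Prod.fst '' Ω, ω₁ x = ω₂ x)) := by
  refine ⟨fun C22 C23 C32 C33 D2 D3 h22 h23 h32 h33 hD2 hD3 =>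
    linearInDerivatives_pointTransformable_iff hΩ h22 h23 h32 h33 hD2 hD3, fun ω₁ ω₂ h₁ h₂ => ?_⟩
  -- With C = 0 the first two conditions are trivial and the third reads 0 = ω₂ − ω₁.
  have hosc : anisotropicOscillator ω₁ ω₂ = linearInDerivatives (fun _ => 0) (fun _ => 0) (fun _ => 0) (fun _ => 0)
      (fun p => ω₁ p.1 * p.2.1) (fun p => ω₂ p.1 * p.2.2) := by
    funext p v
    simp [anisotropicOscillator, linearInDerivatives]
  have hω : ∀ {g : ℝ → ℝ}, ContDiffOn ℝ ∞ g (Prod.fst '' Ω) →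
      ContDiffOn ℝ ∞ (fun p : XYZ => g p.1) Ω := fun hg =>
    hg.comp contDiffOn_fst (mapsTo_image _ _)
  rw [hosc, linearInDerivatives_pointTransformable_iff hΩ contDiffOn_const contDiffOn_const
    contDiffOn_const contDiffOn_const ((hω h₁).mul contDiff_snd.fst.contDiffOn)
    ((hω h₂).mul contDiff_snd.snd.contDiffOn)]
  have hω₁ : ∀ p : XYZ, partialY (fun p => ω₁ p.1 * p.2.1) p = ω₁ p.1 := fun p => by
    simp [partialY]
  have hω₂ : ∀ p : XYZ, partialZ (fun p => ω₂ p.1 * p.2.2) p = ω₂ p.1 := fun p => by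
    simp [partialZ]
  have hω₁z : ∀ p : XYZ, partialZ (fun p => ω₁ p.1 * p.2.1) p = 0 := fun p => by
    simp [partialZ]
  have hω₂y : ∀ p : XYZ, partialY (fun p => ω₂ p.1 * p.2.2) p = 0 := fun p => by
    simp [partialY]
  rw [forall_mem_image]
  refine forall₂_congr fun p _ => ?_
  rw [hω₁, hω₂, hω₁z, hω₂y, deriv_const]
  norm_num [sub_eq_zero, eq_comm]
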